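/- **Conventions.** Banach spaces are real; $G$ is a group without topology acting by homeomorphisms on a nonempty compact Hausdorff space $X$. A *Banach $G$-module* is a Banach space with an isometric linear $G$-representation; duals carry the contragredient representation. $C(X)=C(X,\mathbb R)$ has the uniform norm and the translation action $(g\varphi)(x)=\varphi(g^{-1}x)$. For a Banach $G$-module $V$, $C(X,V)$ is the space of norm-continuous maps with the uniform norm and the action $(g\eta)(x)=g\,\eta(g^{-1}x)$; $\ell^1G$ carries left translation. $\mathscr I(C(X),W)$ is the space of (Grothendieck) integral operators $T:C(X)\to W$, i.e. those for which the bilinear form $(\varphi,\lambda)\mapsto\lambda(T\varphi)$ on $C(X)\times W^*$ is bounded for the injective tensor norm on $C(X)\otimes W^*$, with the integral norm (the least such bound) and the action $(gT)(\varphi)=g\,T(g^{-1}\varphi)$. A *$(G,X)$-module* is a Banach $G$-module $E$ that is also a unital module over the algebra $C(X)$ with $\|\varphi u\|\le\|\varphi\|\,\|u\|$ and $g(\varphi(g^{-1}u))=(g\varphi)u$. It is of *type M* if $\sum_i\|\varphi_iu\|\le\|\sum_i\varphi_i\|\,\|u\|$ for all $u\in E$ and finitely many $\varphi_i\ge0$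 in $C(X)$, and of *type C* if $\|\sum_i\varphi_iu_i\|\le\|\sum_i\varphi_i\|\max_i\|u_i\|$ for all finitely many $u_i\in E$ and $\varphi_i\ge0$. A *dual $(G,X)$-module* is the dual $E^*$ of a $(G,X)$-module $E$, with $(\varphi\lambda)(u)=\lambda(\varphi u)$. $\mathrm H_b^n(G,E)$ is the $n$-th cohomology of the complex of bounded $G$-equivariant maps $G^{n+1}\to E$ with the homogeneous coboundary. A Banach $G$-module $E$ is *relatively injective* if, for every Banach $G$-module $B$ and closed $G$-invariant subspace $A\subseteq B$ admitting a (not necessarily equivariant) linear projection $B\to A$ of norm at most one, every bounded $G$-equivariant linear map $\alpha:A\to E$ extends to a bounded $G$-equivariant linear map $\beta:B\to E$ with $\|\beta\|=\|\alpha\|$. The action is *topologically amenable* if there is a net $(\mu^j)$ in $C(X,\ell^1G)$ such that every $\mu^j(x)$ is a probability on $G$ and $\|g\mu^j-\mu^j\|\to0$ for every $g\in G$. An element of $C(X,\ell^1G)^{**}$ *sums to $1_X$* if its image in $C(X)^{**}$ under the bidual of the summation map $C(X,\ell^1G)\to C(X)$ is the canonical image of the constant function $1_X$; it is *positive* if it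 is nonnegative on every positive functional on $C(X,\ell^1G)$. **Proposition.** The following are equivalent. 1. The $G$-action on $X$ is topologically amenable. 2. $\mathrm H_b^n(G,C(X,V)^{**})=0$ for every Banach $G$-module $V$ and every $n\ge1$. 3. $\mathrm H_b^n(G,\mathscr I(C(X),W)^*)=0$ for every Banach $G$-module $W$ and every $n\ge1$. 4. $\mathrm H_b^n(G,E^*)=0$ for every $(G,X)$-module $E$ of type M and every $n\ge1$. 5. Any one of the statements 2, 3, 4 holds for $n=1$ (that is, each of the three statements with $n=1$ only is equivalent to all the others). 6. $C(X,V)^{**}$ is relatively injective for every Banach $G$-module $V$. 7. $\mathscr I(C(X),W)^*$ is relatively injective for every Banach $G$-module $W$. 8. Every dual $(G,X)$-module of type C is a relatively injective Banach $G$-module. 9. There is a $G$-invariant element in $C(X,\ell^1G)^{**}$ summing to $1_X$. 10. There is a positive $G$-invariant element of norm one in $C(X,\ell^1G)^{**}$ summing to $1_X$. -/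

import Mathlib

open Filter Topology
open scoped ENNReal lp TensorProduct

noncomputable section

/-! # Isometric representations on real normed spaces -/

/-- An isometric linear representation of the (discrete) group `G` on a real normed space `E`.
A *Banach `G`-module* is a complete `E` with such a representation. -/
abbrev IsometricRep (G E : Type*) [Group G] [NormedAddCommGroup E] [NormedSpace ℝ E] :=
  G →* (E ≃ₗᵢ[ℝ] E)

/-- A linear action by contractions is an isometric representation. -/
def IsometricRep.ofContractions {G E : Type*} [Group G] [NormedAddCommGroup E] [NormedSpace ℝ E]
    (T : G → E →ₗ[ℝ] E) (h_one : ∀ u, T 1 u = u) (h_mul : ∀ g h u, T (g * h) u = T g (T h u))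
    (h_le : ∀ g u, ‖T g u‖ ≤ ‖u‖) : IsometricRep G E where
  toFun g :=
    { toLinearEquiv := LinearEquiv.ofLinearMap (T g) (T g⁻¹)
        (by ext u; simp [← h_mul, h_one]) (by ext u; simp [← h_mul, h_one])
      norm_map' := fun u => le_antisymm (h_le g u) (by
        have h := h_le g⁻¹ (T g u)
        rw [← h_mul, inv_mul_cancel, h_one] at h
        exact h) }
  map_one' := by ext u; exact h_one u
  map_mul' g h := by ext u; exact h_mul g h u

@[simp] theorem IsometricRep.ofContractions_apply {G E : Type*} [Group G] [NormedAddCommGroup E]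
    [NormedSpace ℝ E] (T : G → E →ₗ[ℝ] E) (h_one : ∀ u, T 1 u = u)
    (h_mul : ∀ g h u, T (g * h) u = T g (T h u)) (h_le : ∀ g u, ‖T g u‖ ≤ ‖u‖) (g : G) (u : E) :
    IsometricRep.ofContractions T h_one h_mul h_le g u = T g u := rfl

/-- The contragredient representation on the dual: `(g • l) u = l (g⁻¹ • u)`. -/
def IsometricRep.dual {G E : Type*} [Group G] [NormedAddCommGroup E] [NormedSpace ℝ E]
    (ρ : IsometricRep G E) : IsometricRep G (StrongDual ℝ E) :=
  IsometricRep.ofContractions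
    (fun g =>
      { toFun := fun l => l.comp (ρ g⁻¹).toContinuousLinearEquiv.toContinuousLinearMap
        map_add' := fun _ _ => rfl
        map_smul' := fun _ _ => rfl })
    (fun l => by ext u; simp)
    (fun g h l => by ext u; simp)
    (fun g l => by
      refine ContinuousLinearMap.opNorm_le_bound _ (norm_nonneg _) fun u => ?_
      have h := l.le_opNorm (ρ g⁻¹ u)
      rwa [LinearIsometryEquiv.norm_map] at h)

@[simp] theorem IsometricRep.dual_apply {G E : Type*} [Group G] [NormedAddCommGroup E]
    [NormedSpace ℝ E] (ρ : IsometricRep G E) (g : G) (l : StrongDual ℝ E) (u : E) :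
    ρ.dual g l u = l (ρ g⁻¹ u) := rfl

/-- `E` is relatively injective: every `G`-morphism (bounded equivariant linear map) `α : A → E`
from a closed invariant subspace `A` of a Banach `G`-module `B` that is the range of a projection
`σ : B → A` of norm at most one extends to a `G`-morphism `β : B → E` with `‖β‖ = ‖α‖`. The
projection `σ` need not be equivariant. -/
def IsRelativelyInjective.{b, u, w} {G : Type u} {E : Type w} [Group G] [NormedAddCommGroup E]
    [NormedSpace ℝ E] (ρ : IsometricRep G E) : Prop :=
  ∀ (B : Type b) [NormedAddCommGroup B] [NormedSpace ℝ B] [CompleteSpace B]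
    (τ : IsometricRep G B) (A : Submodule ℝ B) (_ : IsClosed (A : Set B))
    (hA : ∀ (g : G) (a : A), τ g a ∈ A)
    (σ : B →L[ℝ] A) (_ : ∀ a : A, σ a = a) (_ : ‖σ‖ ≤ 1)
    (α : A →L[ℝ] E) (_ : ∀ (g : G) (a : A), α ⟨τ g a, hA g a⟩ = ρ g (α a)),
    ∃ β : B →L[ℝ] E, (∀ a : A, β a = α a) ∧ (∀ (g : G) (b : B), β (τ g b) = ρ g (β b)) ∧
      ‖β‖ = ‖α‖

/-! # Bounded cohomology -/

section BoundedCohomology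

/-- The homogeneous coboundary `(d f)(g₀, …, g_{n+1}) = ∑ (-1)^i f(g₀, …, ĝ_i, …, g_{n+1})`. -/
def coboundaryMap (G E : Type*) [NormedAddCommGroup E] [NormedSpace ℝ E] (n : ℕ) :
    ((Fin (n + 1) → G) → E) →ₗ[ℝ] ((Fin (n + 2) → G) → E) where
  toFun f v := ∑ i : Fin (n + 2), (-1 : ℝ) ^ (i : ℕ) • f (fun j => v (i.succAbove j))
  map_add' f f' := by
    ext v
    simp [Finset.sum_add_distrib]
  map_smul' c f := by
    ext v
    simp [Finset.smul_sum, smul_comm c]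

theorem coboundaryMap_comp {G E : Type*} [NormedAddCommGroup E] [NormedSpace ℝ E] (n : ℕ)
    (f : (Fin (n + 1) → G) → E) :
    coboundaryMap G E (n + 1) (coboundaryMap G E n f) = 0 := by
  ext v
  simp only [coboundaryMap, LinearMap.coe_mk, AddHom.coe_mk, Finset.smul_sum, Pi.zero_apply]
  rw [← Finset.sum_product']
  refine Finset.sum_involution (fun p _ => (p.1.succAbove p.2, p.2.predAbove p.1)) ?_ ?_ ?_ ?_
  · rintro ⟨i, j⟩ -
    have hs : (-1 : ℝ) ^ ((i.succAbove j : ℕ) + (j.predAbove i : ℕ)) =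
        -(-1 : ℝ) ^ ((i : ℕ) + (j : ℕ)) := by
      rcases Fin.lt_or_le j.castSucc i with h | h
      · have hi : (i : ℕ) = (j.predAbove i : ℕ) + 1 := by
          rw [Fin.predAbove_of_castSucc_lt _ _ h, Fin.val_pred]
          have := Fin.lt_def.1 h
          omega
        rw [Fin.succAbove_of_castSucc_lt _ _ h, Fin.val_castSucc, hi]
        ring
      · rw [Fin.succAbove_of_le_castSucc _ _ h, Fin.predAbove_of_le_castSucc _ _ h, Fin.val_succ,
          Fin.coe_castPred]
        ring
    simp only [smul_smul, ← pow_add, hs, Fin.succAbove_succAbove_succAbove_predAbove, neg_smul,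
      add_neg_cancel]
  · rintro ⟨i, j⟩ - - h
    exact Fin.succAbove_ne i j (Prod.ext_iff.1 h).1
  · simp
  · rintro ⟨i, j⟩ -
    simp only [Fin.succAbove_succAbove_predAbove, Fin.predAbove_predAbove_succAbove]

variable {G E : Type*} [Group G] [NormedAddCommGroup E] [NormedSpace ℝ E]

/-- Homogeneous bounded `n`-cochains: the bounded `G`-equivariant maps `G ^ (n + 1) → E`. -/
def boundedCochains (ρ : IsometricRep G E) (n : ℕ) : Submodule ℝ ((Fin (n + 1) → G) → E) where
  carrier := {f | (∃ C : ℝ, ∀ v, ‖f v‖ ≤ C) ∧ ∀ (g : G) v, f (fun i => g * v i) = ρ g (f v)}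
  zero_mem' := ⟨⟨0, fun _ => by simp⟩, fun _ _ => by simp⟩
  add_mem' := by
    rintro f f' ⟨⟨C, hC⟩, hf⟩ ⟨⟨C', hC'⟩, hf'⟩
    exact ⟨⟨C + C', fun v => norm_add_le_of_le (hC v) (hC' v)⟩, fun g v => by
      simp [hf, hf']⟩
  smul_mem' := by
    rintro c f ⟨⟨C, hC⟩, hf⟩
    exact ⟨⟨‖c‖ * C, fun v => by
      simpa [norm_smul] using mul_le_mul_of_nonneg_left (hC v) (abs_nonneg c)⟩,
      fun g v => by simp [hf]⟩

/-- Bounded `n`-cocycles: the kernel of the coboundary on bounded cochains. -/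
def boundedCocycles (ρ : IsometricRep G E) (n : ℕ) : Submodule ℝ ((Fin (n + 1) → G) → E) :=
  boundedCochains ρ n ⊓ LinearMap.ker (coboundaryMap G E n)

/-- Bounded `n`-coboundaries: the image of the bounded `(n - 1)`-cochains, and `0` if `n = 0`. -/
def boundedCoboundaries (ρ : IsometricRep G E) :
    (n : ℕ) → Submodule ℝ ((Fin (n + 1) → G) → E)
  | 0 => ⊥
  | n + 1 => (boundedCochains ρ n).map (coboundaryMap G E n)

theorem boundedCoboundaries_le (ρ : IsometricRep G E) (n : ℕ) :
    boundedCoboundaries ρ n ≤ boundedCocycles ρ n := by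
  cases n with
  | zero => exact bot_le
  | succ n =>
    rintro _ ⟨f, ⟨⟨C, hC⟩, hf⟩, rfl⟩
    refine ⟨⟨⟨∑ _i : Fin (n + 2), C, fun v => ?_⟩, fun g v => ?_⟩, coboundaryMap_comp n f⟩
    · simp only [coboundaryMap, LinearMap.coe_mk, AddHom.coe_mk]
      refine norm_sum_le_of_le _ fun i _ => ?_
      simpa [norm_smul] using hC _
    · simp only [coboundaryMap, LinearMap.coe_mk, AddHom.coe_mk]
      rw [map_sum]
      refine Finset.sum_congr rfl fun i _ => ?_
      rw [map_smul, ← hf]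

/-- The bounded cohomology `H_b^n(G, E)`: bounded cocycles modulo bounded coboundaries. -/
abbrev BoundedCohomology (ρ : IsometricRep G E) (n : ℕ) :=
  ↥(boundedCocycles ρ n) ⧸ (boundedCoboundaries ρ n).submoduleOf (boundedCocycles ρ n)

end BoundedCohomology

/-! # Continuous maps on a `G`-space -/

section ContinuousMaps

variable {G X : Type*} [Group G] [TopologicalSpace X] [MulAction G X] [ContinuousConstSMul G X]

/-- Translation of maps on `X`: `(g φ)(x) = φ(g⁻¹ x)`. -/
def translateMap {V : Type*} [TopologicalSpace V] (g : G) (φ : C(X, V)) : C(X, V) :=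
  ⟨fun x => φ (g⁻¹ • x), φ.continuous.comp (continuous_const_smul g⁻¹)⟩

@[simp] theorem translateMap_apply {V : Type*} [TopologicalSpace V] (g : G) (φ : C(X, V)) (x : X) :
    translateMap g φ x = φ (g⁻¹ • x) := rfl

variable (X) in
/-- The diagonal action on `C(X, V)` (with the uniform norm): `(g η)(x) = g η(g⁻¹ x)`. -/
def IsometricRep.onC {V : Type*} [CompactSpace X] [NormedAddCommGroup V] [NormedSpace ℝ V]
    (ρ : IsometricRep G V) : IsometricRep G C(X, V) :=
  IsometricRep.ofContractions
    (fun g =>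
      { toFun := fun η => ⟨fun x => ρ g (translateMap g η x),
          (ρ g).continuous.comp (translateMap g η).continuous⟩
        map_add' := fun _ _ => by ext x; simp
        map_smul' := fun _ _ => by ext x; simp })
    (fun η => by ext x; simp)
    (fun g h η => by ext x; simp [mul_smul])
    (fun g η => by
      refine (ContinuousMap.norm_le _ (norm_nonneg _)).2 fun x => ?_
      simpa using η.norm_coe_le_norm (g⁻¹ • x))

@[simp] theorem IsometricRep.onC_apply {V : Type*} [CompactSpace X] [NormedAddCommGroup V]
    [NormedSpace ℝ V] (ρ : IsometricRep G V) (g : G) (η : C(X, V)) (x : X) :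
    ρ.onC X g η x = ρ g (η (g⁻¹ • x)) := rfl

end ContinuousMaps

/-- The trivial representation. -/
def IsometricRep.trivial (G V : Type*) [Group G] [NormedAddCommGroup V] [NormedSpace ℝ V] :
    IsometricRep G V := 1

/-- The left regular representation on `ℓ¹ G`: `(g f)(h) = f(g⁻¹ h)`. -/
def leftRegular (G : Type*) [Group G] : IsometricRep G ℓ^1(G, ℝ) :=
  IsometricRep.ofContractions
    (fun g =>
      { toFun := fun f => ⟨fun h => f (g⁻¹ * h), by
          have hf := (memℓp_gen_iff (p := 1) (by simp)).1 (lp.memℓp f)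
          exact (memℓp_gen_iff (p := 1) (by simp)).2 ((Equiv.mulLeft g⁻¹).summable_iff.2 hf)⟩
        map_add' := fun _ _ => rfl
        map_smul' := fun _ _ => rfl })
    (fun f => by ext h; simp)
    (fun g k f => by
      ext h
      exact congrArg (f : G → ℝ) (show (g * k)⁻¹ * h = k⁻¹ * (g⁻¹ * h) by
        rw [mul_inv_rev, mul_assoc]))
    (fun g f => by
      rw [lp.norm_eq_tsum_rpow (by simp), lp.norm_eq_tsum_rpow (by simp)]
      exact le_of_eq (congrArg (fun t : ℝ => t ^ (1 / (1 : ℝ≥0∞).toReal))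
        ((Equiv.mulLeft g⁻¹).tsum_eq (fun h => ‖f h‖ ^ (1 : ℝ≥0∞).toReal))))

@[simp] theorem leftRegular_apply {G : Type*} [Group G] (g : G) (f : ℓ^1(G, ℝ)) (h : G) :
    leftRegular G g f h = f (g⁻¹ * h) := rfl

/-! # `C(X)`-modules and `(G, X)`-modules -/

section Modules

variable {X E : Type*} [TopologicalSpace X] [NormedAddCommGroup E]
  [NormedSpace ℝ E]

/-- Type M: `∑ ‖φ_i u‖ ≤ ‖∑ φ_i‖ ‖u‖` for all `u` and all finite families `φ_i ≥ 0`. -/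
def IsTypeM [CompactSpace X] (π : C(X, ℝ) →ₐ[ℝ] (E →L[ℝ] E)) : Prop :=
  ∀ (n : ℕ) (φ : Fin n → C(X, ℝ)) (u : E), (∀ i, 0 ≤ φ i) →
    ∑ i, ‖π (φ i) u‖ ≤ ‖∑ i, φ i‖ * ‖u‖

/-- Type C: `‖∑ φ_i u_i‖ ≤ ‖∑ φ_i‖ max_i ‖u_i‖` for all finite families `u_i` and `φ_i ≥ 0`.
The norm of `u : Fin n → E` is the maximum of the `‖u i‖`. -/
def IsTypeC [CompactSpace X] (π : C(X, ℝ) →ₐ[ℝ] (E →L[ℝ] E)) : Prop :=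
  ∀ (n : ℕ) (φ : Fin n → C(X, ℝ)) (u : Fin n → E), (∀ i, 0 ≤ φ i) →
    ‖∑ i, π (φ i) (u i)‖ ≤ ‖∑ i, φ i‖ * ‖u‖

/-- A representation `ρ` of `G` on `E` and a (unital) module structure `π` of the algebra `C(X)`
on `E` form a `(G, X)`-module: `‖φ u‖ ≤ ‖φ‖ ‖u‖`, and `g φ g⁻¹` acts on `E` as the translate of
`φ` by `g`. -/
structure IsGXModule {G : Type*} [CompactSpace X] [Group G] [MulAction G X] [ContinuousConstSMul G X]
    (ρ : IsometricRep G E) (π : C(X, ℝ) →ₐ[ℝ] (E →L[ℝ] E)) : Prop where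
  norm_le : ∀ (φ : C(X, ℝ)) (u : E), ‖π φ u‖ ≤ ‖φ‖ * ‖u‖
  conj : ∀ (g : G) (φ : C(X, ℝ)) (u : E), ρ g (π φ (ρ g⁻¹ u)) = π (translateMap g φ) u

/-- The dual `C(X)`-module structure on `E*`: `(φ l)(u) = l(φ u)`. -/
def dualCModule (π : C(X, ℝ) →ₐ[ℝ] (E →L[ℝ] E)) :
    C(X, ℝ) →ₐ[ℝ] (StrongDual ℝ E →L[ℝ] StrongDual ℝ E) where
  toFun φ := (ContinuousLinearMap.compL ℝ E E ℝ).flip (π φ)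
  map_one' := by ext l u; simp
  map_mul' φ ψ := by ext l u; rw [mul_comm φ ψ]; simp
  map_zero' := by ext l u; simp
  map_add' φ ψ := by ext l u; simp
  commutes' r := by ext l u; simp [Algebra.algebraMap_eq_smul_one]

@[simp] theorem dualCModule_apply (π : C(X, ℝ) →ₐ[ℝ] (E →L[ℝ] E)) (φ : C(X, ℝ))
    (l : StrongDual ℝ E) (u : E) : dualCModule π φ l u = l (π φ u) := rfl

end Modules

/-! # Integral operators -/

section Integral

variable {E F E' F' : Type*} [NormedAddCommGroup E] [NormedSpace ℝ E] [NormedAddCommGroup F]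
  [NormedSpace ℝ F] [NormedAddCommGroup E'] [NormedSpace ℝ E'] [NormedAddCommGroup F']
  [NormedSpace ℝ F']

/-- The value `(φ ⊗ ψ)(t)` of a pair of functionals on `t ∈ E ⊗ F`. -/
def tensorEval (φ : StrongDual ℝ E) (ψ : StrongDual ℝ F) : E ⊗[ℝ] F →ₗ[ℝ] ℝ :=
  LinearMap.mul' ℝ ℝ ∘ₗ TensorProduct.map φ.toLinearMap ψ.toLinearMap

@[simp] theorem tensorEval_tmul (φ : StrongDual ℝ E) (ψ : StrongDual ℝ F) (e : E) (f : F) :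
    tensorEval φ ψ (e ⊗ₜ f) = φ e * ψ f := by
  simp [tensorEval]

/-- The injective tensor norm of `t ∈ E ⊗ F`: the supremum of `|(φ ⊗ ψ)(t)|` over `φ`, `ψ` in the
closed unit balls of `E*`, `F*`. -/
def injectiveTensorNorm (t : E ⊗[ℝ] F) : ℝ :=
  ⨆ p : {p : StrongDual ℝ E × StrongDual ℝ F // ‖p.1‖ ≤ 1 ∧ ‖p.2‖ ≤ 1},
    |tensorEval p.1.1 p.1.2 t|

theorem injectiveTensorNorm_bddAbove (t : E ⊗[ℝ] F) :
    BddAbove (Set.range fun p : {p : StrongDual ℝ E × StrongDual ℝ F // ‖p.1‖ ≤ 1 ∧ ‖p.2‖ ≤ 1} =>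
      |tensorEval p.1.1 p.1.2 t|) := by
  induction t using TensorProduct.induction_on with
  | zero => exact ⟨0, by rintro _ ⟨p, rfl⟩; simp⟩
  | tmul e f =>
    refine ⟨‖e‖ * ‖f‖, ?_⟩
    rintro _ ⟨⟨⟨φ, ψ⟩, hφ, hψ⟩, rfl⟩
    simp only [tensorEval_tmul, abs_mul]
    have h1 := φ.le_of_opNorm_le hφ e
    have h2 := ψ.le_of_opNorm_le hψ f
    rw [one_mul, Real.norm_eq_abs] at h1 h2
    exact mul_le_mul h1 h2 (abs_nonneg _) (norm_nonneg _)
  | add s t hs ht =>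
    obtain ⟨C, hC⟩ := hs
    obtain ⟨D, hD⟩ := ht
    refine ⟨C + D, ?_⟩
    rintro _ ⟨p, rfl⟩
    simp only [map_add]
    exact (abs_add_le _ _).trans (add_le_add (hC ⟨p, rfl⟩) (hD ⟨p, rfl⟩))

theorem abs_tensorEval_le (t : E ⊗[ℝ] F) {φ : StrongDual ℝ E} {ψ : StrongDual ℝ F}
    (hφ : ‖φ‖ ≤ 1) (hψ : ‖ψ‖ ≤ 1) : |tensorEval φ ψ t| ≤ injectiveTensorNorm t :=
  le_ciSup (injectiveTensorNorm_bddAbove t) ⟨(φ, ψ), hφ, hψ⟩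

theorem injectiveTensorNorm_nonneg (t : E ⊗[ℝ] F) : 0 ≤ injectiveTensorNorm t :=
  Real.iSup_nonneg fun _ => abs_nonneg _

/-- Contractions on both factors contract the injective tensor norm. -/
theorem injectiveTensorNorm_map_le (a : E →L[ℝ] E') (b : F →L[ℝ] F') (ha : ‖a‖ ≤ 1)
    (hb : ‖b‖ ≤ 1) (t : E ⊗[ℝ] F) :
    injectiveTensorNorm (TensorProduct.map a.toLinearMap b.toLinearMap t) ≤
      injectiveTensorNorm t := by
  refine Real.iSup_le ?_ (injectiveTensorNorm_nonneg t)
  rintro ⟨⟨φ, ψ⟩, hφ, hψ⟩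
  have h : tensorEval φ ψ (TensorProduct.map a.toLinearMap b.toLinearMap t) =
      tensorEval (φ.comp a) (ψ.comp b) t := by
    induction t using TensorProduct.induction_on with
    | zero => simp
    | tmul e f => simp
    | add s t hs ht => simp only [map_add, hs, ht]
  simp only [h]
  exact abs_tensorEval_le t
    ((φ.opNorm_comp_le a).trans (mul_le_one₀ hφ (norm_nonneg _) ha))
    ((ψ.opNorm_comp_le b).trans (mul_le_one₀ hψ (norm_nonneg _) hb))

/-- The bilinear form `(e, l) ↦ l (T e)` on `E × F*` attached to `T : E → F`, as a linear form on
the tensor product. -/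
def operatorForm : (E →L[ℝ] F) →ₗ[ℝ] (E ⊗[ℝ] StrongDual ℝ F →ₗ[ℝ] ℝ) where
  toFun T := TensorProduct.lift (LinearMap.mk₂ ℝ (fun e l => l (T e))
    (fun _ _ _ => by simp) (fun _ _ _ => by simp) (fun _ _ _ => by simp) (fun _ _ _ => by simp))
  map_add' S T := by ext e l; simp
  map_smul' c T := by ext e l; simp

@[simp] theorem operatorForm_tmul (T : E →L[ℝ] F) (e : E) (l : StrongDual ℝ F) :
    operatorForm T (e ⊗ₜ l) = l (T e) := by
  simp [operatorForm]

/-- `C` is an integral bound for `T : E → F` if the bilinear form of `T` on `E × F*` is bounded by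
`C` for the injective tensor norm. -/
def IsIntegralBound (T : E →L[ℝ] F) (C : ℝ) : Prop :=
  0 ≤ C ∧ ∀ t : E ⊗[ℝ] StrongDual ℝ F, |operatorForm T t| ≤ C * injectiveTensorNorm t

theorem IsIntegralBound.add {S T : E →L[ℝ] F} {C D : ℝ} (hS : IsIntegralBound S C)
    (hT : IsIntegralBound T D) : IsIntegralBound (S + T) (C + D) :=
  ⟨add_nonneg hS.1 hT.1, fun t => by
    rw [map_add, LinearMap.add_apply, add_mul]
    exact (abs_add_le _ _).trans (add_le_add (hS.2 t) (hT.2 t))⟩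

theorem IsIntegralBound.smul {T : E →L[ℝ] F} {C : ℝ} (c : ℝ) (hT : IsIntegralBound T C) :
    IsIntegralBound (c • T) (|c| * C) :=
  ⟨mul_nonneg (abs_nonneg c) hT.1, fun t => by
    rw [map_smul, LinearMap.smul_apply, smul_eq_mul, abs_mul, mul_assoc]
    exact mul_le_mul_of_nonneg_left (hT.2 t) (abs_nonneg c)⟩

theorem IsIntegralBound.comp {T : E →L[ℝ] F} {C : ℝ} (hT : IsIntegralBound T C)
    (a : E' →L[ℝ] E) (b : F →L[ℝ] F') (ha : ‖a‖ ≤ 1) (hb : ‖b‖ ≤ 1) :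
    IsIntegralBound (b.comp (T.comp a)) C := by
  refine ⟨hT.1, fun t => ?_⟩
  let b' : StrongDual ℝ F' →L[ℝ] StrongDual ℝ F := (ContinuousLinearMap.compL ℝ F F' ℝ).flip b
  have hb' : ‖b'‖ ≤ 1 := ContinuousLinearMap.opNorm_le_bound _ zero_le_one fun l => by
    rw [one_mul]
    exact (l.opNorm_comp_le b).trans (mul_le_of_le_one_right (norm_nonneg _) hb)
  have h : operatorForm (b.comp (T.comp a)) t =
      operatorForm T (TensorProduct.map a.toLinearMap b'.toLinearMap t) := by
    induction t using TensorProduct.induction_on with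
    | zero => simp
    | tmul e f => simp [b']
    | add s t hs ht => simp only [map_add, hs, ht]
  rw [h]
  exact (hT.2 _).trans
    (mul_le_mul_of_nonneg_left (injectiveTensorNorm_map_le a b' ha hb' t) hT.1)

variable (E F) in
/-- The (Grothendieck) integral operators from `E` to `F`, as a subspace of the bounded operators. -/
def integralSubmodule : Submodule ℝ (E →L[ℝ] F) where
  carrier := {T | ∃ C, IsIntegralBound T C}
  zero_mem' := ⟨0, le_rfl, fun t => by simp⟩
  add_mem' := fun ⟨_, hS⟩ ⟨_, hT⟩ => ⟨_, hS.add hT⟩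
  smul_mem' := fun c _ ⟨_, hT⟩ => ⟨_, hT.smul c⟩

variable (E F) in
/-- The space `𝓘(E, F)` of integral operators; it is normed by the integral norm (below), not by the
operator norm. -/
def IntegralOperator := ↥(integralSubmodule E F)

namespace IntegralOperator

instance : AddCommGroup (IntegralOperator E F) :=
  inferInstanceAs (AddCommGroup (integralSubmodule E F))

instance : Module ℝ (IntegralOperator E F) :=
  inferInstanceAs (Module ℝ (integralSubmodule E F))

/-- The underlying bounded operator. -/
def toCLM : IntegralOperator E F →ₗ[ℝ] (E →L[ℝ] F) := (integralSubmodule E F).subtype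

theorem toCLM_injective : Function.Injective (toCLM : IntegralOperator E F → (E →L[ℝ] F)) :=
  Subtype.val_injective

/-- The integral norm: the least integral bound. -/
instance : Norm (IntegralOperator E F) := ⟨fun T => sInf {C | IsIntegralBound (toCLM T) C}⟩

theorem norm_def (T : IntegralOperator E F) : ‖T‖ = sInf {C | IsIntegralBound (toCLM T) C} := rfl

theorem bounds_bddBelow (T : E →L[ℝ] F) : BddBelow {C | IsIntegralBound T C} :=
  ⟨0, fun _ h => h.1⟩

theorem norm_le_of_bound {T : IntegralOperator E F} {C : ℝ} (h : IsIntegralBound (toCLM T) C) :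
    ‖T‖ ≤ C :=
  csInf_le (bounds_bddBelow _) h

/-- The infimum in the definition of the integral norm is attained. -/
theorem isIntegralBound_norm (T : IntegralOperator E F) : IsIntegralBound (toCLM T) ‖T‖ := by
  have hne : {C | IsIntegralBound (toCLM T) C}.Nonempty := T.2
  refine ⟨le_csInf hne fun _ h => h.1, fun t => ?_⟩
  rcases (injectiveTensorNorm_nonneg t).eq_or_lt with h0 | h0
  · obtain ⟨C, hC⟩ := hne
    have h := hC.2 t
    rw [← h0, mul_zero] at h ⊢
    exact h
  · rw [← div_le_iff₀ h0]
    exact le_csInf hne fun C hC => (div_le_iff₀ h0).2 (hC.2 t)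

theorem core : NormedSpace.Core ℝ (IntegralOperator E F) where
  norm_nonneg T := (isIntegralBound_norm T).1
  norm_triangle S T := norm_le_of_bound (by
    rw [map_add]; exact (isIntegralBound_norm S).add (isIntegralBound_norm T))
  norm_smul c T := by
    have key : ∀ (c : ℝ) (T : IntegralOperator E F), ‖c • T‖ ≤ ‖c‖ * ‖T‖ := fun c T =>
      norm_le_of_bound (by rw [map_smul]; exact (isIntegralBound_norm T).smul c)
    refine le_antisymm (key c T) ?_
    rcases eq_or_ne c 0 with rfl | hc
    · simpa using (isIntegralBound_norm ((0 : ℝ) • T)).1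
    · have h := key c⁻¹ (c • T)
      rw [smul_smul, inv_mul_cancel₀ hc, one_smul, norm_inv] at h
      rwa [← le_inv_mul_iff₀ (norm_pos_iff.2 hc)]
  norm_eq_zero_iff T := by
    constructor
    · intro h
      apply toCLM_injective
      rw [map_zero]
      ext e
      refine SeparatingDual.eq_zero_of_forall_dual_eq_zero (R := ℝ) fun l => ?_
      have h1 := (isIntegralBound_norm T).2 (e ⊗ₜ l)
      rw [h, zero_mul, operatorForm_tmul] at h1
      exact abs_nonpos_iff.1 h1
    · rintro rfl
      exact le_antisymm (norm_le_of_bound ⟨le_rfl, fun t => by simp⟩) (isIntegralBound_norm _).1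

instance : NormedAddCommGroup (IntegralOperator E F) := NormedAddCommGroup.ofCore core

instance : NormedSpace ℝ (IntegralOperator E F) := NormedSpace.ofCore core

/-- Composition with contractions on both sides. -/
def conj (a : E →L[ℝ] E) (b : F →L[ℝ] F) (ha : ‖a‖ ≤ 1) (hb : ‖b‖ ≤ 1) :
    IntegralOperator E F →ₗ[ℝ] IntegralOperator E F where
  toFun T := ⟨b.comp ((toCLM T).comp a), _, (isIntegralBound_norm T).comp a b ha hb⟩
  map_add' S T := toCLM_injective (by
    change b.comp ((toCLM (S + T)).comp a) = b.comp ((toCLM S).comp a) + b.comp ((toCLM T).comp a)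
    ext e; simp)
  map_smul' c T := toCLM_injective (by
    change b.comp ((toCLM (c • T)).comp a) = c • b.comp ((toCLM T).comp a)
    ext e; simp)

@[simp] theorem toCLM_conj (a : E →L[ℝ] E) (b : F →L[ℝ] F) (ha : ‖a‖ ≤ 1) (hb : ‖b‖ ≤ 1)
    (T : IntegralOperator E F) : toCLM (conj a b ha hb T) = b.comp ((toCLM T).comp a) := rfl

end IntegralOperator

theorem IsometricRep.norm_toCLM_le {G : Type*} [Group G] (ρ : IsometricRep G E) (g : G) :
    ‖(ρ g).toContinuousLinearEquiv.toContinuousLinearMap‖ ≤ 1 :=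
  ContinuousLinearMap.opNorm_le_bound _ zero_le_one fun u => by simp

/-- The action on integral operators by conjugation: `(g T)(e) = g T(g⁻¹ e)`. -/
def IsometricRep.onIntegral {G : Type*} [Group G] (ρ : IsometricRep G E) (τ : IsometricRep G F) :
    IsometricRep G (IntegralOperator E F) :=
  IsometricRep.ofContractions
    (fun g => IntegralOperator.conj (ρ g⁻¹).toContinuousLinearEquiv.toContinuousLinearMap
      (τ g).toContinuousLinearEquiv.toContinuousLinearMap (ρ.norm_toCLM_le _) (τ.norm_toCLM_le _))
    (fun T => IntegralOperator.toCLM_injective (by ext e; simp))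
    (fun g h T => IntegralOperator.toCLM_injective (by ext e; simp))
    (fun g T => IntegralOperator.norm_le_of_bound
      ((IntegralOperator.isIntegralBound_norm T).comp _ _ (ρ.norm_toCLM_le _) (τ.norm_toCLM_le _)))

@[simp] theorem IsometricRep.onIntegral_apply {G : Type*} [Group G] (ρ : IsometricRep G E)
    (τ : IsometricRep G F) (g : G) (T : IntegralOperator E F) (e : E) :
    IntegralOperator.toCLM (ρ.onIntegral τ g T) e =
      τ g (IntegralOperator.toCLM T (ρ g⁻¹ e)) := rfl

end Integral

/-! # Amenability of actions and invariant means -/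

section Amenability

variable (G X : Type*) [Group G] [TopologicalSpace X] [CompactSpace X]

/-- The action of `G` on `C(X)` by translation. -/
def functionRep [MulAction G X] [ContinuousConstSMul G X] : IsometricRep G C(X, ℝ) :=
  (IsometricRep.trivial G ℝ).onC X

/-- The diagonal action of `G` on `C(X, ℓ¹ G)`. -/
def crossedRep [MulAction G X] [ContinuousConstSMul G X] : IsometricRep G C(X, ℓ^1(G, ℝ)) :=
  (leftRegular G).onC X

/-- The summation map `C(X, ℓ¹ G) → C(X)`. -/
def summation : C(X, ℓ^1(G, ℝ)) →L[ℝ] C(X, ℝ) :=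
  (lp.tsumCLM ℝ G ℝ).compLeftContinuous ℝ X

/-- `m ∈ C(X, ℓ¹ G)**` sums to `1_X`: its image in `C(X)**` under the bidual of the summation map is
the image of the constant function `1`. -/
def SumsToOne (m : StrongDual ℝ (StrongDual ℝ C(X, ℓ^1(G, ℝ)))) : Prop :=
  ∀ l : StrongDual ℝ C(X, ℝ), m (l.comp (summation G X)) = l 1

/-- Positivity in the bidual of the Banach lattice `C(X, ℓ¹ G)`: `m` is nonnegative on all positive
functionals. -/
def IsPositiveBidual (m : StrongDual ℝ (StrongDual ℝ C(X, ℓ^1(G, ℝ)))) : Prop :=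
  ∀ l : StrongDual ℝ C(X, ℓ^1(G, ℝ)),
    (∀ f : C(X, ℓ^1(G, ℝ)), (∀ x h, 0 ≤ f x h) → 0 ≤ l f) → 0 ≤ m l

end Amenability

/-- The action of `G` on `X` is topologically amenable: there is a net of continuous maps
`μ j : X → ℓ¹ G` with values in the probabilities on `G` and `‖g μ j - μ j‖ → 0` for every `g`. (The
index sets may be taken in the universe of `G` since `Finset G × ℕ` always suffices.) -/
def IsTopologicallyAmenable.{u, v} (G : Type u) (X : Type v) [Group G] [TopologicalSpace X]
    [CompactSpace X] [MulAction G X] [ContinuousConstSMul G X] : Prop :=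
  ∃ (J : Type u) (_ : Preorder J) (_ : IsDirectedOrder J) (_ : Nonempty J)
    (μ : J → C(X, ℓ^1(G, ℝ))),
    (∀ j x, (∀ h, 0 ≤ μ j x h) ∧ HasSum (fun h => μ j x h) 1) ∧
    ∀ g : G, Tendsto (fun j => ‖crossedRep G X g (μ j) - μ j‖) atTop (𝓝 0)

end

universe u v w

/-!
The pivot of the equivalences is an invariant element `m` of `C(X, ℓ¹ G)**` that sums to `1_X`, i.e.
an invariant mean for the action.

*Amenability and invariant elements.* A weak-* cluster point of a net of almost invariant
probabilities is invariant, positive, of norm one, and sums to `1_X`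
(`IsTopologicallyAmenable.exists_invariant`). Conversely, given any invariant `m` that sums to
`1_X`, the Hahn–Banach theorem gives maps `η : X → ℓ¹ G` that are almost invariant in norm and sum
to almost `1`: a functional separating `(0, 1)` from all `((g η - η)_g, ∑ η)` would be a relation
between functionals that evaluation at `m` contradicts (`exists_almost_invariant`). Normalizing
`|η|` pointwise gives probabilities (`isTopologicallyAmenable_of_invariant`).

*From `m` to vanishing and injectivity.* If `E*` is of type C, a bounded function `f : G → E*` and
`u ∈ E` define the functional `η ↦ ∑ f(h)(η_h u)` on `C(X, ℓ¹ G)`, of norm at most `‖f‖ ‖u‖`.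
Evaluating `m` on it yields an equivariant contraction `ℓ^∞(G, E*) → E*` that is the identity on
constants (`IsGXModule.hasEquivariantMean`). Such a mean gives both relative injectivity and the
vanishing of bounded cohomology in all positive degrees. The dual of a module of type M is of type C
and the dual of one of type C is of type M; `C(X, V)` is of type C by inspection, and `𝓘(C(X), W)`
is of type M because the injective norm on `C(X) ⊗ W*` is of type C.

*Back to `m`.* Relative injectivity gives an equivariant mean, hence vanishing in degree one. If the
first cohomology with coefficients in `C(X, V)**` vanishes for `V` the kernel of the sum on `ℓ¹ G`,
then the cocycle `(g, h) ↦ δ_h - δ_g` bounds an equivariant `f`, and `δ_g - f(g)` is the required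
`m` (`exists_invariant_of_subsingleton_boundedCohomology`). For the coefficients `𝓘(C(X), V*)*` the
same works, because each functional on `C(X, V)` is an integral operator `C(X) → V*`; this is seen
by approximating tensors along partitions of unity (`isIntegralBound_functionalOperator`).
-/

noncomputable section

/-! ### Modules of type M and of type C -/

section Types

variable {X E : Type*} [TopologicalSpace X] [CompactSpace X] [NormedAddCommGroup E]
  [NormedSpace ℝ E] {π : C(X, ℝ) →ₐ[ℝ] (E →L[ℝ] E)}

theorem IsTypeC.norm_sum_le (h : IsTypeC π) {ι : Type*} [Fintype ι] (φ : ι → C(X, ℝ)) (u : ι → E)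
    {C : ℝ} (hC : 0 ≤ C) (hu : ∀ i, ‖u i‖ ≤ C) (hφ : ∀ i, 0 ≤ φ i) :
    ‖∑ i, π (φ i) (u i)‖ ≤ ‖∑ i, φ i‖ * C := by
  let e := Fintype.equivFin ι
  have := h _ (φ ∘ e.symm) (u ∘ e.symm) fun i => hφ _
  simp only [Function.comp_apply] at this
  rw [e.symm.sum_comp (fun i => π (φ i) (u i)), e.symm.sum_comp φ] at this
  refine this.trans (mul_le_mul_of_nonneg_left ?_ (norm_nonneg _))
  exact (pi_norm_le_iff_of_nonneg hC).2 fun i => hu _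

/-- The type C inequality for functions of arbitrary sign, by splitting each `φ i` into its positive
and negative parts. -/
theorem IsTypeC.norm_sum_le_abs (h : IsTypeC π) {ι : Type*} (s : Finset ι) (φ : ι → C(X, ℝ))
    (u : ι → E) {C : ℝ} (hC : 0 ≤ C) (hu : ∀ i, ‖u i‖ ≤ C) :
    ‖∑ i ∈ s, π (φ i) (u i)‖ ≤ ‖∑ i ∈ s, |φ i|‖ * C := by
  have := h.norm_sum_le (ι := s ⊕ s) (Sum.elim (fun i => (φ i)⁺) (fun i => (φ i)⁻))
    (Sum.elim (fun i => u i) (fun i => -u i)) hC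
    (by rintro (i | i) <;> simp [hu]) (by rintro (i | i) <;> simp [posPart_nonneg, negPart_nonneg])
  simp only [Fintype.sum_sum_type, Sum.elim_inl, Sum.elim_inr] at this
  rw [← Finset.sum_add_distrib, ← Finset.sum_add_distrib,
    Finset.sum_coe_sort s (fun i => π (φ i)⁺ (u i) + π (φ i)⁻ (-u i)),
    Finset.sum_coe_sort s (fun i => (φ i)⁺ + (φ i)⁻)] at this
  simp only [posPart_add_negPart, map_neg, ← sub_eq_add_neg, ← sub_apply, ← map_sub,
    posPart_sub_negPart] at this
  exact this

theorem IsTypeM.isTypeC_dual (h : IsTypeM π) : IsTypeC (dualCModule π) := by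
  intro n φ u hφ
  refine ContinuousLinearMap.opNorm_le_bound _ (by positivity) fun v => ?_
  rw [sum_apply]
  calc ‖∑ i, dualCModule π (φ i) (u i) v‖ ≤ ∑ i, ‖u‖ * ‖π (φ i) v‖ :=
        norm_sum_le_of_le _ fun i _ => (u i).le_of_opNorm_le (norm_le_pi_norm u i) _
    _ = ‖u‖ * ∑ i, ‖π (φ i) v‖ := by rw [Finset.mul_sum]
    _ ≤ ‖u‖ * (‖∑ i, φ i‖ * ‖v‖) := by gcongr; exact h n φ v hφ
    _ = ‖∑ i, φ i‖ * ‖u‖ * ‖v‖ := by ring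

/-- Almost norming vectors: if `c < ‖l‖`, then `c ≤ l u` for some `u` in the closed unit ball. -/
theorem exists_le_apply_of_lt_norm (l : StrongDual ℝ E) {c : ℝ} (hc : c < ‖l‖) :
    ∃ u : E, ‖u‖ ≤ 1 ∧ c ≤ l u := by
  obtain ⟨u, hu, hcu⟩ := l.exists_lt_apply_of_lt_opNorm hc
  rcases le_or_gt 0 (l u) with h | h
  · exact ⟨u, hu.le, by rw [Real.norm_of_nonneg h] at hcu; exact hcu.le⟩
  · exact ⟨-u, by rw [norm_neg]; exact hu.le, by
      rw [Real.norm_of_nonpos h.le] at hcu; rw [map_neg]; exact hcu.le⟩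

/-- Choose `u_i` in the unit ball almost norming `φ_i l`; the type C inequality bounds
`∑ (φ_i l)(u_i) = l(∑ φ_i u_i)`. -/
theorem IsTypeC.isTypeM_dual (h : IsTypeC π) : IsTypeM (dualCModule π) := by
  intro n φ l hφ
  refine le_of_forall_pos_le_add fun ε hε => ?_
  have hδ : 0 < ε / (n + 1) := by positivity
  choose u hu hlu using fun i => exists_le_apply_of_lt_norm (dualCModule π (φ i) l)
    (sub_lt_self _ hδ)
  calc ∑ i, ‖dualCModule π (φ i) l‖ ≤ ∑ i, (dualCModule π (φ i) l (u i) + ε / (n + 1)) :=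
        Finset.sum_le_sum fun i _ => by linarith [hlu i]
    _ = l (∑ i, π (φ i) (u i)) + n * (ε / (n + 1)) := by
        simp [Finset.sum_add_distrib, map_sum]
    _ ≤ ‖l‖ * (‖∑ i, φ i‖ * 1) + ε := by
        gcongr
        · exact (le_abs_self _).trans (l.le_opNorm_of_le (h.norm_sum_le φ u zero_le_one hu hφ))
        · rw [mul_div_assoc', div_le_iff₀ (by positivity)]
          nlinarith
    _ = ‖∑ i, φ i‖ * ‖l‖ + ε := by ring

theorem IsGXModule.dual {G : Type*} [Group G] [MulAction G X] [ContinuousConstSMul G X]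
    {ρ : IsometricRep G E} (h : IsGXModule ρ π) : IsGXModule ρ.dual (dualCModule π) where
  norm_le φ l := ContinuousLinearMap.opNorm_le_bound _ (by positivity) fun u => by
    calc ‖l (π φ u)‖ ≤ ‖l‖ * (‖φ‖ * ‖u‖) := l.le_opNorm_of_le (h.norm_le φ u)
      _ = ‖φ‖ * ‖l‖ * ‖u‖ := by ring
  conj g φ l := by
    ext u
    have hφ : translateMap g⁻¹ (translateMap g φ) = φ := by ext x; simp
    have := h.conj g⁻¹ (translateMap g φ) (ρ g⁻¹ u)
    rw [hφ] at this
    simp only [IsometricRep.dual_apply, dualCModule_apply, ← this]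
    simp

end Types

/-! ### Bounded functions on the group and equivariant means -/

section Means

variable {G E : Type*} [Group G] [NormedAddCommGroup E] [NormedSpace ℝ E]

theorem IsometricRep.map_mul_apply (ρ : IsometricRep G E) (g h : G) (u : E) :
    ρ (g * h) u = ρ g (ρ h u) := by
  rw [map_mul]; rfl

/-- The bounded function `f : G → E` as an element of `ℓ^∞(G, E)`. -/
def boundedFunction (f : G → E) {C : ℝ} (hf : ∀ h, ‖f h‖ ≤ C) : ℓ^∞(G, E) :=
  ⟨f, memℓp_infty ⟨C, by rintro _ ⟨h, rfl⟩; exact hf h⟩⟩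

omit [Group G] [NormedSpace ℝ E] in
@[simp] theorem boundedFunction_apply (f : G → E) {C : ℝ} (hf : ∀ h, ‖f h‖ ≤ C) (h : G) :
    boundedFunction f hf h = f h := rfl

omit [NormedSpace ℝ E] in
theorem norm_boundedFunction_le (f : G → E) {C : ℝ} (hf : ∀ h, ‖f h‖ ≤ C) :
    ‖boundedFunction f hf‖ ≤ C :=
  lp.norm_le_of_forall_le ((norm_nonneg _).trans (hf 1)) hf

/-- The action of `G` on `ℓ^∞(G, E)` given by `(g f)(h) = g f(g⁻¹ h)`. -/
def IsometricRep.onBounded (ρ : IsometricRep G E) : IsometricRep G ℓ^∞(G, E) :=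
  IsometricRep.ofContractions
    (fun g =>
      { toFun := fun f => boundedFunction (fun h => ρ g (f (g⁻¹ * h))) (C := ‖f‖) fun h => by
          rw [LinearIsometryEquiv.norm_map]
          exact lp.norm_apply_le_norm (by simp) f _
        map_add' := fun f f' => by ext h; simp
        map_smul' := fun c f => by ext h; simp })
    (fun f => by ext h; simp)
    (fun g k f => by ext h; simp [mul_assoc])
    (fun g f => norm_boundedFunction_le _ fun h => by
      rw [LinearIsometryEquiv.norm_map]
      exact lp.norm_apply_le_norm (by simp) f _)

@[simp] theorem IsometricRep.onBounded_apply (ρ : IsometricRep G E) (g : G) (f : ℓ^∞(G, E))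
    (h : G) : ρ.onBounded g f h = ρ g (f (g⁻¹ * h)) := rfl

variable (G E) in
/-- The embedding of `E` into `ℓ^∞(G, E)` as the constant functions. -/
def constantFunctions : E →ₗᵢ[ℝ] ℓ^∞(G, E) where
  toFun e := boundedFunction (fun _ => e) fun _ => le_rfl
  map_add' _ _ := rfl
  map_smul' _ _ := rfl
  norm_map' e := le_antisymm (norm_boundedFunction_le _ fun _ => le_rfl)
    (lp.norm_apply_le_norm (by simp)
      (boundedFunction (fun _ : G => e) fun _ => le_rfl : ℓ^∞(G, E)) 1)

@[simp] theorem constantFunctions_apply (e : E) (h : G) : constantFunctions G E e h = e := rfl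

/-- `E` carries an equivariant mean: an equivariant contraction `ℓ^∞(G, E) → E` which is the
identity on constant functions. -/
def HasEquivariantMean (ρ : IsometricRep G E) : Prop :=
  ∃ M : ℓ^∞(G, E) →L[ℝ] E, ‖M‖ ≤ 1 ∧ (∀ e, M (constantFunctions G E e) = e) ∧
    ∀ g f, M (ρ.onBounded g f) = ρ g (M f)

/-- Extend `α` by averaging `h ↦ h α(σ(h⁻¹ b))` over `G`. -/
theorem HasEquivariantMean.isRelativelyInjective {ρ : IsometricRep G E}
    (hρ : HasEquivariantMean ρ) : IsRelativelyInjective ρ := by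
  obtain ⟨M, hM, hconst, hequiv⟩ := hρ
  intro B _ _ _ τ A _ hA σ hσA hσ α hα
  have hbound : ∀ b h, ‖ρ h (α (σ (τ h⁻¹ b)))‖ ≤ ‖α‖ * ‖b‖ := fun b h => by
    rw [LinearIsometryEquiv.norm_map]
    refine α.le_opNorm_of_le ?_
    simpa using σ.le_of_opNorm_le hσ (τ h⁻¹ b)
  let β₀ : B →L[ℝ] ℓ^∞(G, E) := LinearMap.mkContinuous
    { toFun := fun b => boundedFunction (fun h => ρ h (α (σ (τ h⁻¹ b)))) (hbound b)
      map_add' := fun b b' => by ext h; simp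
      map_smul' := fun c b => by ext h; simp } ‖α‖ fun b => norm_boundedFunction_le _ (hbound b)
  have hβ₀ : ∀ b h, β₀ b h = ρ h (α (σ (τ h⁻¹ b))) := fun _ _ => rfl
  have hext : ∀ a : A, M (β₀ a) = α a := fun a => by
    rw [← hconst (α a)]
    congr 1
    ext h
    have h1 : τ h⁻¹ a = ((⟨τ h⁻¹ a, hA h⁻¹ a⟩ : A) : B) := rfl
    rw [hβ₀, h1, hσA, hα, constantFunctions_apply, ← ρ.map_mul_apply]
    simp
  refine ⟨M.comp β₀, hext, fun g b => ?_, le_antisymm ?_ ?_⟩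
  · rw [ContinuousLinearMap.comp_apply, ContinuousLinearMap.comp_apply, ← hequiv]
    congr 1
    ext h
    simp only [hβ₀, IsometricRep.onBounded_apply]
    rw [← ρ.map_mul_apply, ← τ.map_mul_apply]
    simp
  · refine ContinuousLinearMap.opNorm_le_bound _ α.opNorm_nonneg fun b => ?_
    calc ‖M (β₀ b)‖ ≤ 1 * ‖β₀ b‖ := M.le_of_opNorm_le hM _
      _ ≤ ‖α‖ * ‖b‖ := by rw [one_mul]; exact norm_boundedFunction_le _ (hbound b)
  · refine ContinuousLinearMap.opNorm_le_bound _ (norm_nonneg _) fun a => ?_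
    rw [← hext a]
    exact (M.comp β₀).le_opNorm a

/-- The identity of `E`, viewed as a map on the constant functions in `ℓ^∞(G, E)`, extends to an
equivariant mean; evaluation at `1` is the required projection. -/
theorem IsRelativelyInjective.hasEquivariantMean {G : Type u} {E : Type (max u w)}
    [Group G] [NormedAddCommGroup E] [NormedSpace ℝ E] [CompleteSpace E] {ρ : IsometricRep G E}
    (hρ : IsRelativelyInjective.{max u w} ρ) : HasEquivariantMean ρ := by
  let κ := constantFunctions G E
  let A : Submodule ℝ ℓ^∞(G, E) := LinearMap.range κ.toLinearMap
  have hclosed : IsClosed (A : Set ℓ^∞(G, E)) :=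
    κ.isometry.isClosedEmbedding.isClosed_range
  have hA : ∀ (g : G) (a : A), ρ.onBounded g a ∈ A := by
    rintro g ⟨_, e, rfl⟩
    exact ⟨ρ g e, rfl⟩
  let ev : ℓ^∞(G, E) →L[ℝ] E := lp.evalCLM ℝ (fun _ : G => E) ∞ 1
  have hev : ∀ f, ev f = f 1 := fun _ => rfl
  let σ : ℓ^∞(G, E) →L[ℝ] A := LinearMap.mkContinuous
    { toFun := fun f => ⟨κ (f 1), f 1, rfl⟩
      map_add' := fun _ _ => rfl
      map_smul' := fun _ _ => rfl } 1 fun f => by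
        rw [one_mul]
        exact (κ.norm_map _).trans_le (lp.norm_apply_le_norm (by simp) f 1)
  have hσ : ∀ f, σ f = ⟨κ (f 1), f 1, rfl⟩ := fun _ => rfl
  obtain ⟨β, hβ, hequiv, hnorm⟩ := hρ ℓ^∞(G, E) ρ.onBounded A hclosed hA σ
    (by rintro ⟨_, e, rfl⟩; rfl)
    (LinearMap.mkContinuous_norm_le _ zero_le_one _)
    (ev.comp A.subtypeL) (by rintro g ⟨_, e, rfl⟩; rfl)
  refine ⟨β, hnorm.trans_le ?_, fun e => hβ ⟨κ e, e, rfl⟩, hequiv⟩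
  refine ContinuousLinearMap.opNorm_le_bound _ zero_le_one fun a => ?_
  rw [one_mul]
  exact lp.norm_apply_le_norm (by simp) (a : ℓ^∞(G, E)) 1

/-- Averaging a cocycle in its first variable gives a cochain of which it is the coboundary. -/
theorem HasEquivariantMean.subsingleton_boundedCohomology {ρ : IsometricRep G E}
    (hρ : HasEquivariantMean ρ) {n : ℕ} (hn : 1 ≤ n) :
    Subsingleton (BoundedCohomology ρ n) := by
  obtain ⟨M, -, hconst, hequiv⟩ := hρ
  obtain ⟨n, rfl⟩ := Nat.exists_eq_add_of_le' hn
  rw [Submodule.Quotient.subsingleton_iff, Submodule.submoduleOf_eq_top]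
  rintro f ⟨⟨⟨C, hC⟩, hf⟩, hd⟩
  let F : (Fin (n + 1) → G) → ℓ^∞(G, E) := fun v =>
    boundedFunction (fun h => f (Fin.cons h v)) fun h => hC _
  refine ⟨fun v => M (F v), ⟨⟨‖M‖ * C, fun v => ?_⟩, fun g v => ?_⟩, ?_⟩
  · exact M.le_opNorm_of_le (norm_boundedFunction_le _ fun h => hC _)
  · dsimp only
    rw [← hequiv]
    congr 1
    ext h
    change f (Fin.cons h fun i => g * v i) = ρ g (f (Fin.cons (g⁻¹ * h) v))
    rw [← hf]
    congr 1
    ext i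
    refine Fin.cases ?_ (fun i => ?_) i <;> simp
  · ext v
    change ∑ i : Fin (n + 2), (-1 : ℝ) ^ (i : ℕ) • M (F fun j => v (i.succAbove j)) = f v
    simp only [← map_smul, ← map_sum]
    rw [← hconst (f v)]
    congr 1
    ext h
    have hd' := congrFun (LinearMap.mem_ker.1 hd) (Fin.cons h v)
    simp only [coboundaryMap, LinearMap.coe_mk, AddHom.coe_mk, Pi.zero_apply] at hd'
    rw [Fin.sum_univ_succ] at hd'
    have h0 : (fun j => (Fin.cons h v : Fin (n + 3) → G) ((0 : Fin (n + 3)).succAbove j)) = v := by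
      ext j; simp
    have hs : ∀ i : Fin (n + 2),
        (fun j => (Fin.cons h v : Fin (n + 3) → G) (i.succ.succAbove j)) =
          Fin.cons h fun j => v (i.succAbove j) := fun i => by
      ext j
      refine Fin.cases ?_ (fun j => ?_) j <;> simp
    simp only [h0, hs, Fin.val_succ, pow_succ, mul_neg, mul_one, neg_smul, Fin.val_zero, pow_zero,
      one_smul, Finset.sum_neg_distrib] at hd'
    rw [lp.coeFn_sum, Finset.sum_apply]
    simpa [F] using (add_neg_eq_zero.1 hd').symm

end Means

/-! ### Coordinates of maps into `ℓ^1(G, ℝ)` -/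

section Coordinates

variable {G X : Type*} [TopologicalSpace X]

theorem lpOne_hasSum_norm (v : ℓ^1(G, ℝ)) : HasSum (fun h => |v h|) ‖v‖ := by
  simpa using lp.hasSum_norm (p := 1) (by simp) v

theorem lpOne_summable (v : ℓ^1(G, ℝ)) : Summable fun h => v h :=
  (lpOne_hasSum_norm v).summable.of_abs

theorem lpOne_sum_abs_le (v : ℓ^1(G, ℝ)) (s : Finset G) : ∑ h ∈ s, |v h| ≤ ‖v‖ :=
  sum_le_hasSum s (fun _ _ => abs_nonneg _) (lpOne_hasSum_norm v)

/-- The coordinate `x ↦ η(x)(h)` of `η : X → ℓ^1(G, ℝ)`. -/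
def coordinate (h : G) : C(X, ℓ^1(G, ℝ)) →L[ℝ] C(X, ℝ) :=
  (lp.evalCLM ℝ (fun _ : G => ℝ) 1 h).compLeftContinuous ℝ X

@[simp] theorem coordinate_apply (h : G) (η : C(X, ℓ^1(G, ℝ))) (x : X) :
    coordinate h η x = η x h := rfl

theorem sum_abs_coordinate_apply (η : C(X, ℓ^1(G, ℝ))) (s : Finset G) (x : X) :
    (∑ h ∈ s, |coordinate h η|) x = ∑ h ∈ s, |η x h| := by
  simp [ContinuousMap.sum_apply]

variable [CompactSpace X]

theorem norm_sum_abs_coordinate_le (η : C(X, ℓ^1(G, ℝ))) (s : Finset G) :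
    ‖∑ h ∈ s, |coordinate h η|‖ ≤ ‖η‖ := by
  refine (ContinuousMap.norm_le _ (norm_nonneg _)).2 fun x => ?_
  rw [sum_abs_coordinate_apply, Real.norm_of_nonneg (Finset.sum_nonneg fun _ _ => abs_nonneg _)]
  exact (lpOne_sum_abs_le _ s).trans (η.norm_coe_le_norm x)

/-- By Dini's theorem the absolute values of the coordinates sum uniformly to `x ↦ ‖η(x)‖`; hence
the sum of the coordinates converges uniformly as well. -/
theorem hasSum_coordinate (η : C(X, ℓ^1(G, ℝ))) :
    HasSum (fun h => coordinate h η) (summation G X η) := by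
  have habs : HasSum (fun h => |coordinate h η|) (⟨fun x => ‖η x‖, by fun_prop⟩ : C(X, ℝ)) := by
    refine ContinuousMap.tendsto_of_monotone_of_pointwise ?_ fun x => ?_
    · intro s t hst
      exact Finset.sum_le_sum_of_subset_of_nonneg hst fun _ _ _ => abs_nonneg _
    · simp only [sum_abs_coordinate_apply]
      exact lpOne_hasSum_norm (η x)
  have hsum : Summable fun h => coordinate h η := by
    rw [summable_iff_vanishing_norm]
    intro ε hε
    obtain ⟨s, hs⟩ := summable_iff_vanishing_norm.1 habs.summable ε hε
    refine ⟨s, fun t ht => lt_of_le_of_lt ?_ (hs t ht)⟩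
    refine (ContinuousMap.norm_le _ (norm_nonneg _)).2 fun x => ?_
    refine le_trans ?_ ((∑ h ∈ t, |coordinate h η|).norm_coe_le_norm x)
    rw [sum_abs_coordinate_apply, ContinuousMap.sum_apply]
    exact (Finset.abs_sum_le_sum_abs _ _).trans (le_abs_self _)
  convert hsum.hasSum
  ext x
  exact ContinuousMap.tsum_apply hsum x

end Coordinates

/-! ### Means from invariant elements of the bidual -/

section Pairing

variable {G X E : Type*} [TopologicalSpace X] [CompactSpace X] [NormedAddCommGroup E]
  [NormedSpace ℝ E] {π : C(X, ℝ) →ₐ[ℝ] (E →L[ℝ] E)}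

/-- The type C inequality with arbitrary signs bounds the partial sums of the absolute values of the
terms of `∑ f(h)(η_h u)`. -/
theorem IsTypeC.sum_abs_pairing_le (hπ : IsTypeC (dualCModule π)) (f : ℓ^∞(G, StrongDual ℝ E))
    (u : E) (η : C(X, ℓ^1(G, ℝ))) (s : Finset G) :
    ∑ h ∈ s, |f h (π (coordinate h η) u)| ≤ ‖f‖ * ‖u‖ * ‖η‖ := by
  let ε : G → ℝ := fun h => SignType.sign (f h (π (coordinate h η) u))
  have hε : ∀ h, ‖ε h • f h‖ ≤ ‖f‖ := fun h => by
    rw [norm_smul]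
    refine (mul_le_of_le_one_left (norm_nonneg _) ?_).trans (lp.norm_apply_le_norm (by simp) f h)
    change |((SignType.sign (f h (π (coordinate h η) u)) : SignType) : ℝ)| ≤ 1
    rcases SignType.sign (f h (π (coordinate h η) u)) <;> simp
  have key := hπ.norm_sum_le_abs s (fun h => coordinate h η) (fun h => ε h • f h)
    (norm_nonneg f) hε
  calc ∑ h ∈ s, |f h (π (coordinate h η) u)|
      = (∑ h ∈ s, dualCModule π (coordinate h η) (ε h • f h)) u := by
        rw [sum_apply]
        refine Finset.sum_congr rfl fun h _ => ?_
        simp [ε, sign_mul_self]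
    _ ≤ (‖∑ h ∈ s, |coordinate h η|‖ * ‖f‖) * ‖u‖ :=
        (le_abs_self _).trans (ContinuousLinearMap.le_of_opNorm_le _ key u)
    _ ≤ (‖η‖ * ‖f‖) * ‖u‖ := by gcongr; exact norm_sum_abs_coordinate_le η s
    _ = ‖f‖ * ‖u‖ * ‖η‖ := by ring

theorem IsTypeC.summable_pairing (hπ : IsTypeC (dualCModule π)) (f : ℓ^∞(G, StrongDual ℝ E))
    (u : E) (η : C(X, ℓ^1(G, ℝ))) : Summable fun h => f h (π (coordinate h η) u) :=
  (summable_of_sum_le (fun _ => abs_nonneg _) (hπ.sum_abs_pairing_le f u η)).of_abs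

theorem IsTypeC.abs_tsum_pairing_le (hπ : IsTypeC (dualCModule π)) (f : ℓ^∞(G, StrongDual ℝ E))
    (u : E) (η : C(X, ℓ^1(G, ℝ))) :
    |∑' h, f h (π (coordinate h η) u)| ≤ ‖f‖ * ‖u‖ * ‖η‖ :=
  le_of_tendsto (hπ.summable_pairing f u η).hasSum.abs <| Eventually.of_forall fun s =>
    (Finset.abs_sum_le_sum_abs _ _).trans (hπ.sum_abs_pairing_le f u η s)

/-- The functional `η ↦ ∑ f(h)(η_h u)` on `C(X, ℓ^1(G, ℝ))`, where `η_h` is the coordinate of `η` at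
`h`. -/
def IsTypeC.pairing (hπ : IsTypeC (dualCModule π)) (f : ℓ^∞(G, StrongDual ℝ E)) (u : E) :
    StrongDual ℝ C(X, ℓ^1(G, ℝ)) :=
  LinearMap.mkContinuous
    { toFun := fun η => ∑' h, f h (π (coordinate h η) u)
      map_add' := fun η η' => by
        rw [← (hπ.summable_pairing f u η).tsum_add (hπ.summable_pairing f u η')]
        simp
      map_smul' := fun c η => by
        simp [tsum_mul_left] } (‖f‖ * ‖u‖) (hπ.abs_tsum_pairing_le f u)

theorem IsTypeC.pairing_apply (hπ : IsTypeC (dualCModule π)) (f : ℓ^∞(G, StrongDual ℝ E))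
    (u : E) (η : C(X, ℓ^1(G, ℝ))) :
    hπ.pairing f u η = ∑' h, f h (π (coordinate h η) u) := rfl

theorem IsTypeC.norm_pairing_le (hπ : IsTypeC (dualCModule π)) (f : ℓ^∞(G, StrongDual ℝ E))
    (u : E) : ‖hπ.pairing f u‖ ≤ ‖f‖ * ‖u‖ :=
  LinearMap.mkContinuous_norm_le _ (by positivity) _

/-- Integration of bounded functions `G → E*` against an element `m` of the bidual of
`C(X, ℓ^1(G, ℝ))`: the value at `u` is that of `m` on the pairing of `f` and `u`. -/
def IsTypeC.integral (hπ : IsTypeC (dualCModule π))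
    (m : StrongDual ℝ (StrongDual ℝ C(X, ℓ^1(G, ℝ)))) :
    ℓ^∞(G, StrongDual ℝ E) →L[ℝ] StrongDual ℝ E :=
  LinearMap.mkContinuous₂
    (LinearMap.mk₂ ℝ (fun f u => m (hπ.pairing f u))
      (fun f f' u => by
        rw [← map_add]
        congr 1
        ext η
        simpa [hπ.pairing_apply] using
          (hπ.summable_pairing f u η).tsum_add (hπ.summable_pairing f' u η))
      (fun c f u => by
        rw [← map_smul]
        congr 1
        ext η
        simp [hπ.pairing_apply, tsum_mul_left])
      (fun f u u' => by
        rw [← map_add]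
        congr 1
        ext η
        simpa [hπ.pairing_apply] using
          (hπ.summable_pairing f u η).tsum_add (hπ.summable_pairing f u' η))
      (fun c f u => by
        rw [← map_smul]
        congr 1
        ext η
        simp [hπ.pairing_apply, tsum_mul_left])) ‖m‖ fun f u => by
    rw [mul_assoc]
    exact m.le_opNorm_of_le (hπ.norm_pairing_le f u)

theorem IsTypeC.integral_apply (hπ : IsTypeC (dualCModule π))
    (m : StrongDual ℝ (StrongDual ℝ C(X, ℓ^1(G, ℝ)))) (f : ℓ^∞(G, StrongDual ℝ E)) (u : E) :
    hπ.integral m f u = m (hπ.pairing f u) := rfl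

theorem IsTypeC.norm_integral_le (hπ : IsTypeC (dualCModule π))
    (m : StrongDual ℝ (StrongDual ℝ C(X, ℓ^1(G, ℝ)))) :
    ‖(hπ.integral m : ℓ^∞(G, StrongDual ℝ E) →L[ℝ] StrongDual ℝ E)‖ ≤ ‖m‖ :=
  LinearMap.mkContinuous₂_norm_le _ m.opNorm_nonneg _

end Pairing

section Means

variable {G X E : Type*} [Group G] [TopologicalSpace X] [CompactSpace X] [MulAction G X]
  [ContinuousConstSMul G X] [NormedAddCommGroup E] [NormedSpace ℝ E]
  {π : C(X, ℝ) →ₐ[ℝ] (E →L[ℝ] E)} {ρ : IsometricRep G E}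

theorem crossedRep_apply (g : G) (η : C(X, ℓ^1(G, ℝ))) (x : X) (h : G) :
    crossedRep G X g η x h = η (g⁻¹ • x) (g⁻¹ * h) := rfl

/-- On a constant function the pairing factors through the summation map, since the coordinates of
`η` sum uniformly. -/
theorem IsGXModule.pairing_constantFunctions (h : IsGXModule ρ π) (hπ : IsTypeC (dualCModule π))
    (l : StrongDual ℝ E) (u : E) : ∃ k : StrongDual ℝ C(X, ℝ), (∀ φ, k φ = l (π φ u)) ∧
      hπ.pairing (constantFunctions G _ l) u = k.comp (summation G X) := by
  let k : StrongDual ℝ C(X, ℝ) := LinearMap.mkContinuous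
    { toFun := fun φ => l (π φ u)
      map_add' := fun φ ψ => by simp
      map_smul' := fun c φ => by simp } (‖l‖ * ‖u‖) fun φ => by
        calc ‖l (π φ u)‖ ≤ ‖l‖ * (‖φ‖ * ‖u‖) := l.le_opNorm_of_le (h.norm_le φ u)
          _ = ‖l‖ * ‖u‖ * ‖φ‖ := by ring
  refine ⟨k, fun φ => rfl, ?_⟩
  ext η
  exact ((hasSum_coordinate η).mapL k).tsum_eq

theorem IsGXModule.pairing_onBounded (h : IsGXModule ρ π) (hπ : IsTypeC (dualCModule π))
    (g : G) (f : ℓ^∞(G, StrongDual ℝ E)) (u : E) :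
    hπ.pairing (ρ.dual.onBounded g f) u =
      (crossedRep G X).dual g (hπ.pairing f (ρ g⁻¹ u)) := by
  ext η
  rw [IsometricRep.dual_apply, hπ.pairing_apply, hπ.pairing_apply,
    ← (Equiv.mulLeft g).tsum_eq]
  refine tsum_congr fun k => ?_
  have hη : coordinate k (crossedRep G X g⁻¹ η) = translateMap g⁻¹ (coordinate (g * k) η) := by
    ext x
    rw [coordinate_apply, crossedRep_apply]
    simp
  rw [hη, ← h.conj]
  simp

/-- An invariant element of norm at most one that sums to `1_X` yields an equivariant mean on each
dual module of type C. -/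
theorem IsGXModule.hasEquivariantMean (h : IsGXModule ρ π) (hπ : IsTypeC (dualCModule π))
    {m : StrongDual ℝ (StrongDual ℝ C(X, ℓ^1(G, ℝ)))} (hm : ‖m‖ ≤ 1)
    (hinv : ∀ g : G, (crossedRep G X).dual.dual g m = m) (hsum : SumsToOne G X m) :
    HasEquivariantMean ρ.dual := by
  refine ⟨hπ.integral m, (hπ.norm_integral_le m).trans hm, fun l => ?_, fun g f => ?_⟩
  · ext u
    obtain ⟨k, hk, hkl⟩ := h.pairing_constantFunctions hπ l u
    rw [hπ.integral_apply, hkl, hsum, hk]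
    simp
  · ext u
    rw [hπ.integral_apply, h.pairing_onBounded, IsometricRep.dual_apply, hπ.integral_apply]
    conv_rhs => rw [← hinv g⁻¹, IsometricRep.dual_apply, inv_inv]

end Means

/-! ### The module `C(X, V)` -/

section ContinuousModule

variable {X V : Type*} [TopologicalSpace X] [CompactSpace X] [NormedAddCommGroup V]
  [NormedSpace ℝ V]

theorem norm_smul_continuousMap_le (φ : C(X, ℝ)) (η : C(X, V)) : ‖φ • η‖ ≤ ‖φ‖ * ‖η‖ :=
  (ContinuousMap.norm_le _ (by positivity)).2 fun x =>
    (norm_smul_le _ _).trans (mul_le_mul (φ.norm_coe_le_norm x) (η.norm_coe_le_norm x)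
      (norm_nonneg _) (norm_nonneg _))

variable (X V) in
/-- Pointwise multiplication of `V`-valued functions by scalar functions. -/
def pointwiseModule : C(X, ℝ) →ₐ[ℝ] (C(X, V) →L[ℝ] C(X, V)) where
  toFun φ := LinearMap.mkContinuous
    { toFun := fun η => φ • η
      map_add' := fun η η' => smul_add φ η η'
      map_smul' := fun c η => by ext x; exact smul_comm (φ x) c (η x) } ‖φ‖
    (norm_smul_continuousMap_le φ)
  map_one' := by ext η x; simp
  map_mul' φ ψ := by ext η x; simp [mul_smul]
  map_zero' := by ext η x; simp
  map_add' φ ψ := by ext η x; simp [add_smul]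
  commutes' r := by ext η x; simp [Algebra.algebraMap_eq_smul_one]

theorem isTypeC_pointwiseModule : IsTypeC (pointwiseModule X V) := by
  intro n φ u hφ
  refine (ContinuousMap.norm_le _ (by positivity)).2 fun x => ?_
  rw [ContinuousMap.sum_apply]
  calc ‖∑ i, φ i x • u i x‖ ≤ ∑ i, φ i x * ‖u‖ := norm_sum_le_of_le _ fun i _ => by
        rw [norm_smul, Real.norm_of_nonneg (show 0 ≤ φ i x from hφ i x)]
        exact mul_le_mul_of_nonneg_left (((u i).norm_coe_le_norm x).trans (norm_le_pi_norm u i))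
          (hφ i x)
    _ = (∑ i, φ i) x * ‖u‖ := by rw [ContinuousMap.sum_apply, Finset.sum_mul]
    _ ≤ ‖∑ i, φ i‖ * ‖u‖ := by
        gcongr
        exact (le_abs_self _).trans ((∑ i, φ i).norm_coe_le_norm x)

theorem isGXModule_pointwiseModule {G : Type*} [Group G] [MulAction G X] [ContinuousConstSMul G X]
    (ρ : IsometricRep G V) : IsGXModule (ρ.onC X) (pointwiseModule X V) where
  norm_le := norm_smul_continuousMap_le
  conj g φ η := by
    ext x
    change ρ g (φ (g⁻¹ • x) • ρ g⁻¹ (η (g⁻¹⁻¹ • g⁻¹ • x))) = φ (g⁻¹ • x) • η x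
    rw [map_smul, ← ρ.map_mul_apply]
    simp

end ContinuousModule

/-! ### The module of integral operators -/

section IntegralModule

variable {X W : Type*} [TopologicalSpace X] [NormedAddCommGroup W]
  [NormedSpace ℝ W]

section Slice

variable {E F : Type*} [NormedAddCommGroup E] [NormedSpace ℝ E] [NormedAddCommGroup F]
  [NormedSpace ℝ F]

/-- The slice map `e ⊗ f ↦ ψ(f) e`. -/
def tensorSlice (ψ : StrongDual ℝ F) : E ⊗[ℝ] F →ₗ[ℝ] E :=
  (TensorProduct.rid ℝ E).toLinearMap ∘ₗ TensorProduct.map LinearMap.id ψ.toLinearMap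

@[simp] theorem tensorSlice_tmul (ψ : StrongDual ℝ F) (e : E) (f : F) :
    tensorSlice ψ (e ⊗ₜ f) = ψ f • e := by
  simp [tensorSlice]

theorem tensorEval_eq_apply_tensorSlice (φ : StrongDual ℝ E) (ψ : StrongDual ℝ F) (t : E ⊗[ℝ] F) :
    tensorEval φ ψ t = φ (tensorSlice ψ t) := by
  induction t using TensorProduct.induction_on with
  | zero => simp
  | tmul e f => simp [mul_comm]
  | add s t hs ht => simp only [map_add, hs, ht]

end Slice

variable {F : Type*} [NormedAddCommGroup F] [NormedSpace ℝ F]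

/-- Multiplication by `φ` in the first factor of `C(X) ⊗ F`. -/
def tensorMul (φ : C(X, ℝ)) : C(X, ℝ) ⊗[ℝ] F →ₗ[ℝ] C(X, ℝ) ⊗[ℝ] F :=
  TensorProduct.map (LinearMap.mulLeft ℝ φ) LinearMap.id

@[simp] theorem tensorMul_tmul (φ ψ : C(X, ℝ)) (f : F) :
    tensorMul φ (ψ ⊗ₜ[ℝ] f) = (φ * ψ) ⊗ₜ f := rfl

variable [CompactSpace X]

theorem tensorSlice_tensorMul (φ : C(X, ℝ)) (ψ : StrongDual ℝ F) (t : C(X, ℝ) ⊗[ℝ] F) :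
    tensorSlice ψ (tensorMul φ t) = φ * tensorSlice ψ t := by
  induction t using TensorProduct.induction_on with
  | zero => simp
  | tmul e f => simp
  | add s t hs ht => simp only [map_add, hs, ht, mul_add]

theorem abs_tensorSlice_apply_le {ψ : StrongDual ℝ F} (hψ : ‖ψ‖ ≤ 1) (t : C(X, ℝ) ⊗[ℝ] F) (x : X) :
    |tensorSlice ψ t x| ≤ injectiveTensorNorm t := by
  have hx : ‖ContinuousMap.evalCLM ℝ x‖ ≤ (1 : ℝ) :=
    ContinuousLinearMap.opNorm_le_bound _ zero_le_one fun φ : C(X, ℝ) => by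
      rw [one_mul]; exact φ.norm_coe_le_norm x
  have := abs_tensorEval_le t hx hψ
  rwa [tensorEval_eq_apply_tensorSlice] at this

/-- The injective norm on `C(X) ⊗ F` is a supremum over the points of `X`, which makes it a norm of
type C. -/
theorem injectiveTensorNorm_sum_tensorMul_le {ι : Type*} (s : Finset ι) (φ : ι → C(X, ℝ))
    (t : ι → C(X, ℝ) ⊗[ℝ] F) {C : ℝ} (hC : 0 ≤ C) (ht : ∀ i, injectiveTensorNorm (t i) ≤ C) :
    injectiveTensorNorm (∑ i ∈ s, tensorMul (φ i) (t i)) ≤ ‖∑ i ∈ s, |φ i|‖ * C := by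
  refine Real.iSup_le ?_ (by positivity)
  rintro ⟨⟨μ, ψ⟩, hμ, hψ⟩
  simp only [tensorEval_eq_apply_tensorSlice, map_sum (tensorSlice ψ), tensorSlice_tensorMul]
  refine (μ.le_of_opNorm_le hμ _).trans ?_
  rw [one_mul]
  refine (ContinuousMap.norm_le _ (by positivity)).2 fun x => ?_
  rw [ContinuousMap.sum_apply]
  calc ‖∑ i ∈ s, (φ i * tensorSlice ψ (t i)) x‖ ≤ ∑ i ∈ s, |φ i| x * C :=
        norm_sum_le_of_le _ fun i _ => by
          rw [ContinuousMap.mul_apply, norm_mul]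
          exact mul_le_mul_of_nonneg_left ((abs_tensorSlice_apply_le hψ _ x).trans (ht i))
            (abs_nonneg _)
    _ = (∑ i ∈ s, |φ i|) x * C := by rw [ContinuousMap.sum_apply, Finset.sum_mul]
    _ ≤ ‖∑ i ∈ s, |φ i|‖ * C := by
        gcongr
        exact (le_abs_self _).trans ((∑ i ∈ s, |φ i|).norm_coe_le_norm x)

theorem operatorForm_comp_mul (T : C(X, ℝ) →L[ℝ] W) (φ : C(X, ℝ))
    (t : C(X, ℝ) ⊗[ℝ] StrongDual ℝ W) :
    operatorForm (T.comp (ContinuousLinearMap.mul ℝ C(X, ℝ) φ)) t =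
      operatorForm T (tensorMul φ t) := by
  induction t using TensorProduct.induction_on with
  | zero => simp
  | tmul e f => simp
  | add s t hs ht => simp only [map_add, hs, ht]

theorem IsIntegralBound.comp_mul {T : C(X, ℝ) →L[ℝ] W} {C : ℝ} (hT : IsIntegralBound T C)
    (φ : C(X, ℝ)) :
    IsIntegralBound (T.comp (ContinuousLinearMap.mul ℝ C(X, ℝ) φ)) (‖φ‖ * C) := by
  refine ⟨mul_nonneg (norm_nonneg _) hT.1, fun t => ?_⟩
  have h := injectiveTensorNorm_sum_tensorMul_le {()} (fun _ => φ) (fun _ => t)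
    (injectiveTensorNorm_nonneg t) fun _ => le_rfl
  simp only [Finset.sum_singleton] at h
  have habs : ‖|φ|‖ ≤ ‖φ‖ := (ContinuousMap.norm_le _ (norm_nonneg _)).2 fun x => by
    simpa using φ.norm_coe_le_norm x
  replace h := h.trans (mul_le_mul_of_nonneg_right habs (injectiveTensorNorm_nonneg t))
  rw [operatorForm_comp_mul]
  calc |operatorForm T (tensorMul φ t)| ≤ C * injectiveTensorNorm (tensorMul φ t) := hT.2 _
    _ ≤ C * (‖φ‖ * injectiveTensorNorm t) := mul_le_mul_of_nonneg_left h hT.1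
    _ = ‖φ‖ * C * injectiveTensorNorm t := by ring

variable (X W) in
/-- The action of `C(X)` on integral operators by `(φ T)(ψ) = T(φ ψ)`. -/
def integralModule : C(X, ℝ) →ₐ[ℝ]
    (IntegralOperator C(X, ℝ) W →L[ℝ] IntegralOperator C(X, ℝ) W) where
  toFun φ := LinearMap.mkContinuous
    { toFun := fun T => ⟨(IntegralOperator.toCLM T).comp (ContinuousLinearMap.mul ℝ C(X, ℝ) φ), _,
        (IntegralOperator.isIntegralBound_norm T).comp_mul φ⟩
      map_add' := fun _ _ => rfl
      map_smul' := fun _ _ => rfl } ‖φ‖ fun T =>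
    IntegralOperator.norm_le_of_bound ((IntegralOperator.isIntegralBound_norm T).comp_mul φ)
  map_one' := by
    ext T
    refine IntegralOperator.toCLM_injective (ContinuousLinearMap.ext fun ψ => ?_)
    exact congrArg (IntegralOperator.toCLM T) (one_mul ψ)
  map_mul' φ φ' := by
    ext T
    refine IntegralOperator.toCLM_injective (ContinuousLinearMap.ext fun ψ => ?_)
    exact congrArg (IntegralOperator.toCLM T) (by
      change φ * φ' * ψ = φ' * (φ * ψ)
      ring)
  map_zero' := by
    ext T
    refine IntegralOperator.toCLM_injective (ContinuousLinearMap.ext fun ψ => ?_)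
    exact (congrArg (IntegralOperator.toCLM T) (zero_mul ψ)).trans (map_zero _)
  map_add' φ φ' := by
    ext T
    refine IntegralOperator.toCLM_injective (ContinuousLinearMap.ext fun ψ => ?_)
    exact (congrArg (IntegralOperator.toCLM T) (add_mul φ φ' ψ)).trans (map_add _ _ _)
  commutes' r := by
    ext T
    refine IntegralOperator.toCLM_injective (ContinuousLinearMap.ext fun ψ => ?_)
    exact (congrArg (IntegralOperator.toCLM T) (by
      rw [Algebra.algebraMap_eq_smul_one]
      exact smul_one_mul r ψ)).trans (map_smul _ _ _)

theorem toCLM_integralModule (φ : C(X, ℝ)) (T : IntegralOperator C(X, ℝ) W) :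
    IntegralOperator.toCLM (integralModule X W φ T) =
      (IntegralOperator.toCLM T).comp (ContinuousLinearMap.mul ℝ C(X, ℝ) φ) := rfl

/-- The integral norm is the norm of the bilinear form of `T` as a functional on the injective
tensor product. -/
theorem exists_le_operatorForm_of_lt_norm {E : Type*} [NormedAddCommGroup E] [NormedSpace ℝ E]
    (T : IntegralOperator E F) {c : ℝ} (hc : c < ‖T‖) :
    ∃ t : E ⊗[ℝ] StrongDual ℝ F, injectiveTensorNorm t ≤ 1 ∧
      c ≤ operatorForm (IntegralOperator.toCLM T) t := by
  rcases lt_or_ge c 0 with hc0 | hc0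
  · refine ⟨0, ?_, by simpa using hc0.le⟩
    exact Real.iSup_le (fun p => by simp) zero_le_one
  obtain ⟨t, ht⟩ : ∃ t,
      c * injectiveTensorNorm t < |operatorForm (IntegralOperator.toCLM T) t| := by
    by_contra! h
    exact hc.not_ge (IntegralOperator.norm_le_of_bound ⟨hc0, h⟩)
  have hpos : 0 < injectiveTensorNorm t := by
    refine (injectiveTensorNorm_nonneg t).lt_of_ne' fun h0 => ?_
    have := (IntegralOperator.isIntegralBound_norm T).2 t
    rw [h0, mul_zero] at this ht
    exact ht.not_ge this
  have hsmul : ∀ r : ℝ, |r| * injectiveTensorNorm t ≤ 1 → injectiveTensorNorm (r • t) ≤ 1 := by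
    intro r hr
    refine Real.iSup_le ?_ zero_le_one
    rintro ⟨⟨φ, ψ⟩, hφ, hψ⟩
    rw [map_smul, smul_eq_mul, abs_mul]
    exact (mul_le_mul_of_nonneg_left (abs_tensorEval_le t hφ hψ) (abs_nonneg _)).trans hr
  rw [← lt_div_iff₀ hpos] at ht
  rcases le_or_gt 0 (operatorForm (IntegralOperator.toCLM T) t) with h | h
  · refine ⟨(injectiveTensorNorm t)⁻¹ • t, hsmul _ ?_, ?_⟩
    · rw [abs_of_pos (inv_pos.2 hpos), inv_mul_cancel₀ hpos.ne']
    · rw [abs_of_nonneg h, div_eq_inv_mul] at ht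
      rw [map_smul]
      exact ht.le
  · refine ⟨(-(injectiveTensorNorm t)⁻¹) • t, hsmul _ ?_, ?_⟩
    · rw [abs_neg, abs_of_pos (inv_pos.2 hpos), inv_mul_cancel₀ hpos.ne']
    · rw [abs_of_neg h, div_eq_inv_mul] at ht
      rw [map_smul, smul_eq_mul, neg_mul_comm]
      exact ht.le

/-- As for `IsTypeC.isTypeM_dual`, with tensors of injective norm at most one as almost norming
vectors. -/
theorem isTypeM_integralModule : IsTypeM (integralModule X W) := by
  intro n φ T hφ
  refine le_of_forall_pos_le_add fun ε hε => ?_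
  have hδ : 0 < ε / (n + 1) := by positivity
  choose t ht hlt using fun i => exists_le_operatorForm_of_lt_norm (integralModule X W (φ i) T)
    (sub_lt_self _ hδ)
  have key := injectiveTensorNorm_sum_tensorMul_le Finset.univ φ t zero_le_one ht
  simp only [abs_of_nonneg (hφ _), mul_one] at key
  calc ∑ i, ‖integralModule X W (φ i) T‖
      ≤ ∑ i, (operatorForm (IntegralOperator.toCLM T) (tensorMul (φ i) (t i)) + ε / (n + 1)) :=
        Finset.sum_le_sum fun i _ => by
          have := hlt i
          rw [toCLM_integralModule, operatorForm_comp_mul] at this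
          linarith
    _ = operatorForm (IntegralOperator.toCLM T) (∑ i, tensorMul (φ i) (t i)) +
          n * (ε / (n + 1)) := by
        simp [Finset.sum_add_distrib, map_sum]
    _ ≤ ‖T‖ * ‖∑ i, φ i‖ + ε := by
        gcongr
        · exact (le_abs_self _).trans (((IntegralOperator.isIntegralBound_norm T).2 _).trans
            (mul_le_mul_of_nonneg_left key (norm_nonneg _)))
        · rw [mul_div_assoc', div_le_iff₀ (by positivity)]
          nlinarith
    _ = ‖∑ i, φ i‖ * ‖T‖ + ε := by ring

theorem isGXModule_integralModule {G : Type*} [Group G] [MulAction G X] [ContinuousConstSMul G X]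
    (ρ : IsometricRep G W) :
    IsGXModule ((functionRep G X).onIntegral ρ) (integralModule X W) where
  norm_le φ T :=
    IntegralOperator.norm_le_of_bound ((IntegralOperator.isIntegralBound_norm T).comp_mul φ)
  conj g φ T := by
    refine IntegralOperator.toCLM_injective (ContinuousLinearMap.ext fun ψ => ?_)
    rw [IsometricRep.onIntegral_apply, toCLM_integralModule, toCLM_integralModule,
      ContinuousLinearMap.comp_apply, ContinuousLinearMap.comp_apply,
      IsometricRep.onIntegral_apply, ← ρ.map_mul_apply, mul_inv_cancel, map_one]
    change IntegralOperator.toCLM T _ = _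
    congr 1
    ext x
    change φ ((g⁻¹)⁻¹⁻¹ • x) * ψ (g⁻¹⁻¹ • (g⁻¹)⁻¹⁻¹ • x) = φ (g⁻¹ • x) * ψ x
    simp

end IntegralModule

/-! ### Topological amenability and invariant elements of the bidual -/

section AbsoluteValue

variable {G : Type*}

/-- The absolute value on `ℓ^1(G, ℝ)`. -/
def lpOneAbs (v : ℓ^1(G, ℝ)) : ℓ^1(G, ℝ) :=
  ⟨fun h => |v h|, (memℓp_gen_iff (p := 1) (by simp)).2 (by
    simpa using (lpOne_hasSum_norm v).summable)⟩

@[simp] theorem lpOneAbs_apply (v : ℓ^1(G, ℝ)) (h : G) : lpOneAbs v h = |v h| := rfl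

theorem norm_lpOneAbs (v : ℓ^1(G, ℝ)) : ‖lpOneAbs v‖ = ‖v‖ :=
  (lpOne_hasSum_norm (lpOneAbs v)).unique (by simpa using lpOne_hasSum_norm v)

theorem norm_lpOneAbs_sub_le (v w : ℓ^1(G, ℝ)) : ‖lpOneAbs v - lpOneAbs w‖ ≤ ‖v - w‖ :=
  hasSum_le (fun h => abs_abs_sub_abs_le (v h) (w h)) (lpOne_hasSum_norm (lpOneAbs v - lpOneAbs w))
    (lpOne_hasSum_norm (v - w))

theorem continuous_lpOneAbs : Continuous (lpOneAbs : ℓ^1(G, ℝ) → ℓ^1(G, ℝ)) :=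
  (LipschitzWith.mk_one fun v w => by
    rw [dist_eq_norm, dist_eq_norm]
    exact norm_lpOneAbs_sub_le v w).continuous

theorem leftRegular_lpOneAbs [Group G] (g : G) (v : ℓ^1(G, ℝ)) :
    leftRegular G g (lpOneAbs v) = lpOneAbs (leftRegular G g v) := rfl

end AbsoluteValue

theorem norm_normalize_sub_le {E : Type*} [NormedAddCommGroup E] [NormedSpace ℝ E] {v w : E}
    (hv : v ≠ 0) : ‖‖w‖⁻¹ • w - ‖v‖⁻¹ • v‖ ≤ 2 * ‖w - v‖ * ‖v‖⁻¹ := by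
  have hv' : 0 < ‖v‖ := norm_pos_iff.2 hv
  have h1 : ‖w‖⁻¹ • w - ‖v‖⁻¹ • v = (‖w‖⁻¹ - ‖v‖⁻¹) • w + ‖v‖⁻¹ • (w - v) := by module
  have h2 : ‖(‖w‖⁻¹ - ‖v‖⁻¹) • w‖ ≤ ‖w - v‖ * ‖v‖⁻¹ := by
    rcases eq_or_ne w 0 with rfl | hw
    · simp [hv'.ne']
    · have hw' : 0 < ‖w‖ := norm_pos_iff.2 hw
      have : (‖w‖⁻¹ - ‖v‖⁻¹) * ‖w‖ = (‖v‖ - ‖w‖) * ‖v‖⁻¹ := by field_simp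
      rw [norm_smul, ← norm_norm w, ← norm_mul, norm_norm, this, norm_mul, norm_inv, norm_norm]
      gcongr
      rw [norm_sub_rev w v]
      exact abs_norm_sub_norm_le v w
  rw [h1]
  refine (norm_add_le _ _).trans ?_
  rw [norm_smul ‖v‖⁻¹, norm_inv, norm_norm]
  linarith

theorem Submodule.exists_dual_apply_ne_zero_of_notMem_closure {E : Type*} [NormedAddCommGroup E]
    [NormedSpace ℝ E] (S : Submodule ℝ E) {x : E} (hx : x ∉ closure (S : Set E)) :
    ∃ k : StrongDual ℝ E, (∀ y ∈ S, k y = 0) ∧ k x ≠ 0 := by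
  obtain ⟨k, c, hkx, hk⟩ :=
    geometric_hahn_banach_point_closed S.convex.closure isClosed_closure hx
  have hc : c < 0 := by simpa using hk 0 (subset_closure S.zero_mem)
  refine ⟨k, fun y hy => ?_, (hkx.trans hc).ne⟩
  by_contra hne
  -- a linear form that is bounded below on a subspace vanishes there
  have := hk ((c / k y) • y) (subset_closure (S.smul_mem _ hy))
  rw [map_smul, smul_eq_mul, div_mul_cancel₀ _ hne] at this
  exact this.false

section Amenable

variable {G X : Type*} [Group G] [TopologicalSpace X] [CompactSpace X] [MulAction G X]
  [ContinuousConstSMul G X]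

/-- Otherwise the Hahn–Banach theorem separates `(0, 1)` from the subspace of all
`((g η - η)_g, ∑ η)`; evaluating the invariant element `m` on the separating functional gives a
contradiction. -/
theorem exists_almost_invariant {m : StrongDual ℝ (StrongDual ℝ C(X, ℓ^1(G, ℝ)))}
    (hinv : ∀ g : G, (crossedRep G X).dual.dual g m = m) (hsum : SumsToOne G X m)
    (F : Finset G) {ε : ℝ} (hε : 0 < ε) :
    ∃ η : C(X, ℓ^1(G, ℝ)), (∀ g ∈ F, ‖crossedRep G X g η - η‖ < ε) ∧
      ‖summation G X η - 1‖ < ε := by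
  classical
  let D : G → C(X, ℓ^1(G, ℝ)) →L[ℝ] C(X, ℓ^1(G, ℝ)) := fun g =>
    (crossedRep G X g).toContinuousLinearEquiv.toContinuousLinearMap - ContinuousLinearMap.id ℝ _
  let Λ : C(X, ℓ^1(G, ℝ)) →L[ℝ] (F → C(X, ℓ^1(G, ℝ))) × C(X, ℝ) :=
    (ContinuousLinearMap.pi fun g : F => D g).prod (summation G X)
  have hmem : ((0, 1) : (F → C(X, ℓ^1(G, ℝ))) × C(X, ℝ)) ∈
      closure (LinearMap.range Λ.toLinearMap : Set ((F → C(X, ℓ^1(G, ℝ))) × C(X, ℝ))) := by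
    by_contra hnot
    obtain ⟨k, hk, hk1⟩ := Submodule.exists_dual_apply_ne_zero_of_notMem_closure _ hnot
    let l : StrongDual ℝ C(X, ℝ) := k.comp (ContinuousLinearMap.inr ℝ _ _)
    let kg : F → StrongDual ℝ C(X, ℓ^1(G, ℝ)) := fun g =>
      (k.comp (ContinuousLinearMap.inl ℝ _ _)).comp
        (ContinuousLinearMap.single ℝ (fun _ : F => C(X, ℓ^1(G, ℝ))) g)
    have hdec : l.comp (summation G X) =
        ∑ g : F, (kg g - (crossedRep G X).dual (g : G)⁻¹ (kg g)) := by
      ext η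
      have h1 : k (Λ η) = k (0, summation G X η) + k (fun g : F => D g η, 0) := by
        rw [← map_add, Prod.mk_add_mk, zero_add, add_zero]
        rfl
      have h2 : k (fun g : F => D g η, 0) = ∑ g : F, kg g (D g η) := by
        change k.comp (ContinuousLinearMap.inl ℝ _ _) (fun g : F => D g η) = _
        conv_lhs => rw [← Finset.univ_sum_single (fun g : F => D g η), map_sum]
        rfl
      have h0 : k (Λ η) = 0 := hk _ ⟨η, rfl⟩
      rw [h0, h2] at h1
      change k (0, summation G X η) = _
      rw [eq_neg_of_add_eq_zero_left h1.symm, sum_apply, ← Finset.sum_neg_distrib]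
      refine Finset.sum_congr rfl fun g _ => ?_
      change -(kg g (crossedRep G X g η - η)) = kg g η - kg g (crossedRep G X (g : G)⁻¹⁻¹ η)
      rw [inv_inv, map_sub, neg_sub]
    have := hsum l
    rw [hdec, map_sum] at this
    refine hk1 (this.symm.trans (Finset.sum_eq_zero fun g _ => ?_))
    rw [map_sub, sub_eq_zero]
    conv_lhs => rw [← hinv g, IsometricRep.dual_apply]
  obtain ⟨_, ⟨η, rfl⟩, hη⟩ := Metric.mem_closure_iff.1 hmem ε hε
  rw [dist_comm, dist_eq_norm, Prod.norm_def, max_lt_iff] at hη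
  refine ⟨η, fun g hg => ?_, hη.2⟩
  have := (norm_le_pi_norm _ (⟨g, hg⟩ : F)).trans_lt hη.1
  simpa [Λ, D] using this

/-- Normalizing the absolute value of an almost invariant map whose sum is close to `1_X` gives
almost invariant probabilities. -/
theorem exists_almost_invariant_probability {m : StrongDual ℝ (StrongDual ℝ C(X, ℓ^1(G, ℝ)))}
    (hinv : ∀ g : G, (crossedRep G X).dual.dual g m = m) (hsum : SumsToOne G X m)
    (F : Finset G) {ε : ℝ} (hε : 0 < ε) :
    ∃ μ : C(X, ℓ^1(G, ℝ)), (∀ x, (∀ h, 0 ≤ μ x h) ∧ HasSum (fun h => μ x h) 1) ∧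
      ∀ g ∈ F, ‖crossedRep G X g μ - μ‖ ≤ ε := by
  obtain ⟨η, hηF, hη1⟩ := exists_almost_invariant hinv hsum F
    (show 0 < min (ε / 4) (1 / 2) by positivity)
  have hη : ∀ x, 1 / 2 ≤ ‖η x‖ := fun x => by
    have h1 : |∑' h, η x h - 1| < 1 / 2 :=
      ((summation G X η - 1).norm_coe_le_norm x).trans_lt (hη1.trans_le (min_le_right _ _))
    have h2 : ∑' h, η x h ≤ ‖η x‖ :=
      hasSum_le (fun h => le_abs_self _) (lpOne_summable (η x)).hasSum (lpOne_hasSum_norm (η x))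
    linarith [(abs_lt.1 h1).1]
  have hpos : ∀ x, 0 < ‖η x‖ := fun x => lt_of_lt_of_le (by norm_num) (hη x)
  let μ : C(X, ℓ^1(G, ℝ)) := ⟨fun x => ‖η x‖⁻¹ • lpOneAbs (η x),
    (η.continuous.norm.inv₀ fun x => (hpos x).ne').smul (continuous_lpOneAbs.comp η.continuous)⟩
  have hμ : ∀ x, μ x = ‖lpOneAbs (η x)‖⁻¹ • lpOneAbs (η x) := fun x => by rw [norm_lpOneAbs]; rfl
  refine ⟨μ, fun x => ⟨fun h => mul_nonneg (inv_nonneg.2 (norm_nonneg _)) (abs_nonneg _), ?_⟩,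
    fun g hg => (ContinuousMap.norm_le _ hε.le).2 fun x => ?_⟩
  · have := (lpOne_hasSum_norm (η x)).mul_left ‖η x‖⁻¹
    rwa [inv_mul_cancel₀ (hpos x).ne'] at this
  · have hgμ : crossedRep G X g μ x = ‖lpOneAbs (crossedRep G X g η x)‖⁻¹ •
        lpOneAbs (crossedRep G X g η x) := by
      change leftRegular G g (μ (g⁻¹ • x)) = _
      rw [hμ, map_smul, leftRegular_lpOneAbs, norm_lpOneAbs, norm_lpOneAbs]
      change _ = ‖leftRegular G g (η (g⁻¹ • x))‖⁻¹ • _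
      rw [LinearIsometryEquiv.norm_map]
      rfl
    have hne : lpOneAbs (η x) ≠ 0 := norm_pos_iff.1 (by rw [norm_lpOneAbs]; exact hpos x)
    have hle : ‖lpOneAbs (crossedRep G X g η x) - lpOneAbs (η x)‖ ≤ ε / 4 :=
      (norm_lpOneAbs_sub_le _ _).trans
        (((crossedRep G X g η - η).norm_coe_le_norm x).trans
          ((hηF g hg).le.trans (min_le_left _ _)))
    have hinv : ‖η x‖⁻¹ ≤ 2 := by
      rw [inv_le_comm₀ (hpos x) two_pos]
      linarith [hη x]
    rw [ContinuousMap.sub_apply, hgμ, hμ]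
    refine (norm_normalize_sub_le hne).trans ?_
    rw [norm_lpOneAbs (η x)]
    calc 2 * ‖lpOneAbs (crossedRep G X g η x) - lpOneAbs (η x)‖ * ‖η x‖⁻¹
        ≤ 2 * (ε / 4) * 2 := by gcongr
      _ = ε := by ring

theorem isTopologicallyAmenable_of_invariant
    {m : StrongDual ℝ (StrongDual ℝ C(X, ℓ^1(G, ℝ)))}
    (hinv : ∀ g : G, (crossedRep G X).dual.dual g m = m) (hsum : SumsToOne G X m) :
    IsTopologicallyAmenable G X := by
  classical
  choose μ hμ hμinv using fun j : Finset G × ℕ =>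
    exists_almost_invariant_probability hinv hsum j.1 (Nat.one_div_pos_of_nat (α := ℝ) (n := j.2))
  refine ⟨Finset G × ℕ, inferInstance, inferInstance, inferInstance, μ, hμ, fun g => ?_⟩
  refine Metric.tendsto_atTop'.2 fun ε hε => ?_
  obtain ⟨n, hn⟩ := exists_nat_one_div_lt hε
  refine ⟨({g}, n), fun j hj => ?_⟩
  rw [dist_zero_right, norm_norm]
  refine (hμinv j g (hj.le.1 (Finset.mem_singleton_self g))).trans_lt (lt_of_le_of_lt ?_ hn)
  exact Nat.one_div_le_one_div hj.le.2

/-- A weak-* cluster point of the net of almost invariant maps is invariant. -/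
theorem IsTopologicallyAmenable.exists_invariant [Nonempty X]
    (h : IsTopologicallyAmenable G X) :
    ∃ m : StrongDual ℝ (StrongDual ℝ C(X, ℓ^1(G, ℝ))), ‖m‖ = 1 ∧ IsPositiveBidual G X m ∧
      (∀ g : G, (crossedRep G X).dual.dual g m = m) ∧ SumsToOne G X m := by
  obtain ⟨J, _, _, _, μ, hμ, hlim⟩ := h
  have hnorm : ∀ j, ‖μ j‖ ≤ 1 := fun j => (ContinuousMap.norm_le _ zero_le_one).2 fun x => by
    refine ((lpOne_hasSum_norm (μ j x)).unique ?_).le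
    simpa only [abs_of_nonneg ((hμ j x).1 _)] using (hμ j x).2
  have hsum : ∀ j, summation G X (μ j) = 1 := fun j => ContinuousMap.ext fun x =>
    (hμ j x).2.tsum_eq
  let U : Ultrafilter J := Ultrafilter.of atTop
  let ι : J → WeakDual ℝ (StrongDual ℝ C(X, ℓ^1(G, ℝ))) := fun j =>
    StrongDual.toWeakDual (NormedSpace.inclusionInDoubleDual ℝ _ (μ j))
  obtain ⟨w, hw, hwlim⟩ := (WeakDual.isCompact_closedBall (𝕜 := ℝ)
      (0 : StrongDual ℝ (StrongDual ℝ C(X, ℓ^1(G, ℝ)))) 1).ultrafilter_le_nhds (U.map ι) (by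
    refine le_principal_iff.2 (Eventually.of_forall fun j => ?_ : ∀ᶠ j in (U : Filter J), _)
    exact mem_closedBall_zero_iff.2 <| (NormedSpace.double_dual_bound ℝ _ _).trans (hnorm j))
  let m : StrongDual ℝ (StrongDual ℝ C(X, ℓ^1(G, ℝ))) := WeakDual.toStrongDual w
  have hm : ∀ l : StrongDual ℝ C(X, ℓ^1(G, ℝ)), Tendsto (fun j => l (μ j)) U (𝓝 (m l)) :=
    tendsto_iff_forall_eval_tendsto_topDualPairing.1 hwlim
  have hm1 : ‖m‖ ≤ 1 := by simpa using hw
  have hmsum : SumsToOne G X m := fun l =>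
    tendsto_nhds_unique (hm _) (by simp [hsum])
  refine ⟨m, le_antisymm hm1 ?_, fun l hl => ?_, fun g => ?_, hmsum⟩
  · obtain ⟨x⟩ := ‹Nonempty X›
    let δ : StrongDual ℝ C(X, ℝ) := ContinuousMap.evalCLM ℝ x
    have hδ : ‖δ.comp (summation G X)‖ ≤ 1 := by
      refine ContinuousLinearMap.opNorm_le_bound _ zero_le_one fun η => ?_
      rw [one_mul]
      exact (lp.norm_tsum_le (η x)).trans (η.norm_coe_le_norm x)
    calc (1 : ℝ) = m (δ.comp (summation G X)) := by rw [hmsum]; rfl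
      _ ≤ ‖m‖ * 1 := (le_abs_self _).trans (m.le_opNorm_of_le hδ)
      _ = ‖m‖ := mul_one _
  · exact ge_of_tendsto (hm l) (Eventually.of_forall fun j => hl _ fun x k => (hμ j x).1 k)
  · ext l
    have h1 : Tendsto (fun j => l (crossedRep G X g (μ j) - μ j)) U (𝓝 0) := by
      have := ((tendsto_zero_iff_norm_tendsto_zero.2 (hlim g)).mono_left
        (Ultrafilter.of_le (atTop : Filter J)))
      have hl := (l.continuous.tendsto 0).comp this
      rwa [map_zero] at hl
    refine tendsto_nhds_unique (f := fun j => l (crossedRep G X g (μ j)))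
      (l := (U : Filter J)) ?_ ?_
    · have h2 := hm ((crossedRep G X).dual g⁻¹ l)
      simp only [IsometricRep.dual_apply, inv_inv] at h2
      exact h2
    · simpa using h1.add (hm l)

end Amenable

/-! ### Functionals on `C(X, V)` as integral operators -/

section FunctionalOperator

variable {X V : Type*} [TopologicalSpace X] [CompactSpace X] [NormedAddCommGroup V]
  [NormedSpace ℝ V]

variable (X V) in
/-- The embedding of `V` into `C(X, V)` as the constant functions. -/
def constantMaps : V →L[ℝ] C(X, V) := ContinuousLinearMap.const ℝ X

/-- The operator `T : C(X) → V*`, `T(φ)(v) = l(φ v)`, of a functional `l` on `C(X, V)`. -/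
def functionalOperator (l : StrongDual ℝ C(X, V)) : C(X, ℝ) →L[ℝ] StrongDual ℝ V :=
  LinearMap.mkContinuous
    { toFun := fun φ => (dualCModule (pointwiseModule X V) φ l).comp (constantMaps X V)
      map_add' := fun φ φ' => by
        ext v
        change l ((φ + φ') • constantMaps X V v) =
          l (φ • constantMaps X V v) + l (φ' • constantMaps X V v)
        rw [add_smul, map_add]
      map_smul' := fun c φ => by
        ext v
        change l ((c • φ) • constantMaps X V v) = c • l (φ • constantMaps X V v)
        rw [← map_smul l]
        congr 1
        ext x
        exact smul_assoc c (φ x) v } ‖l‖ fun φ => by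
    refine ContinuousLinearMap.opNorm_le_bound _ (by positivity) fun v => ?_
    rw [mul_assoc]
    refine l.le_opNorm_of_le ((norm_smul_continuousMap_le _ _).trans ?_)
    gcongr
    exact (ContinuousMap.norm_le _ (norm_nonneg v)).2 fun x => le_rfl

theorem functionalOperator_apply (l : StrongDual ℝ C(X, V)) (φ : C(X, ℝ)) (v : V) :
    functionalOperator l φ v = l (φ • constantMaps X V v) := rfl

/-- The type M inequality of `C(X, V)*`, restricted to constant maps. -/
theorem sum_norm_functionalOperator_le (l : StrongDual ℝ C(X, V)) (n : ℕ) (χ : Fin n → C(X, ℝ))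
    (hχ : ∀ i, 0 ≤ χ i) : ∑ i, ‖functionalOperator l (χ i)‖ ≤ ‖∑ i, χ i‖ * ‖l‖ := by
  refine (Finset.sum_le_sum fun i _ => ?_).trans (isTypeC_pointwiseModule.isTypeM_dual n χ l hχ)
  refine ContinuousLinearMap.opNorm_le_bound _ (norm_nonneg _) fun v => ?_
  refine ((dualCModule (pointwiseModule X V) (χ i) l).le_opNorm (constantMaps X V v)).trans ?_
  gcongr
  exact (ContinuousMap.norm_le _ (norm_nonneg v)).2 fun x => le_rfl

/-- Finitely many continuous functions can be approximated simultaneously by combinations of a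
partition of unity, with their values at suitable points as coefficients. -/
theorem exists_partition_approx [T2Space X] {k : ℕ} (φ : Fin k → C(X, ℝ)) {ε : ℝ} (hε : 0 < ε) :
    ∃ (n : ℕ) (χ : Fin n → C(X, ℝ)) (x : Fin n → X), (∀ j, 0 ≤ χ j) ∧ ∑ j, χ j = 1 ∧
      ∀ i, ‖φ i - ∑ j, φ i (x j) • χ j‖ ≤ ε := by
  let U : X → Set X := fun x => {y | ∀ i, |φ i y - φ i x| < ε}
  have hU : ∀ x, IsOpen (U x) := fun x => by
    simp only [U, Set.ofPred_forall]
    exact isOpen_iInter_of_finite fun i => isOpen_lt (by fun_prop) continuous_const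
  obtain ⟨s, hs⟩ := isCompact_univ.elim_finite_subcover U hU fun x _ =>
    Set.mem_iUnion.2 ⟨x, fun i => by simpa using hε⟩
  let e := s.equivFin
  obtain ⟨χ, hχU, hχ1, hχ, -⟩ := exists_continuous_sum_one_of_isOpen_isCompact
    (s := fun j => U (e.symm j)) (fun j => hU _) isCompact_univ (fun y hy => by
      obtain ⟨x, hx, hy⟩ := Set.mem_iUnion₂.1 (hs hy)
      exact Set.mem_iUnion.2 ⟨e ⟨x, hx⟩, by simpa using hy⟩)
  have hsum : ∑ j, χ j = 1 := by
    ext y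
    simpa [ContinuousMap.sum_apply] using hχ1 (Set.mem_univ y)
  refine ⟨_, χ, fun j => e.symm j, fun j y => (hχ j y).1, hsum, fun i => ?_⟩
  refine (ContinuousMap.norm_le _ hε.le).2 fun y => ?_
  have hsumy : ∑ j, χ j y = 1 := by
    simpa [ContinuousMap.sum_apply] using congrArg (fun f : C(X, ℝ) => f y) hsum
  have hy : (φ i - ∑ j, φ i (e.symm j) • χ j) y = ∑ j, χ j y * (φ i y - φ i (e.symm j)) := by
    simp only [mul_sub, Finset.sum_sub_distrib, ContinuousMap.sub_apply, ContinuousMap.sum_apply,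
      ContinuousMap.smul_apply, smul_eq_mul]
    rw [← Finset.sum_mul, hsumy, one_mul]
    simp only [mul_comm]
  rw [hy]
  calc ‖∑ j, χ j y * (φ i y - φ i (e.symm j))‖ ≤ ∑ j, χ j y * ε := norm_sum_le_of_le _ fun j _ => by
        rw [norm_mul, Real.norm_of_nonneg (hχ j y).1]
        rcases eq_or_ne (χ j y) 0 with h0 | h0
        · simp [h0]
        · exact mul_le_mul_of_nonneg_left (hχU j (subset_tsupport _ h0) i).le (hχ j y).1
    _ = ε := by rw [← Finset.sum_mul, hsumy, one_mul]

/-- The value at `x` of the `F`-valued map given by a tensor in `C(X) ⊗ F` is bounded by the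
injective norm. -/
theorem norm_sum_smul_le_injectiveTensorNorm {F : Type*} [NormedAddCommGroup F] [NormedSpace ℝ F]
    {k : ℕ} (φ : Fin k → C(X, ℝ)) (ξ : Fin k → F) (x : X) :
    ‖∑ i, φ i x • ξ i‖ ≤ injectiveTensorNorm (∑ i, φ i ⊗ₜ[ℝ] ξ i) := by
  obtain ⟨ψ, hψ, hψξ⟩ := exists_dual_vector'' ℝ (∑ i, φ i x • ξ i)
  refine le_trans (le_of_eq ?_) ((le_abs_self _).trans (abs_tensorSlice_apply_le hψ _ x))
  rw [map_sum, ContinuousMap.sum_apply]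
  refine (hψξ.symm.trans ?_)
  rw [map_sum]
  refine Finset.sum_congr rfl fun i _ => ?_
  rw [tensorSlice_tmul, map_smul, ContinuousMap.smul_apply, smul_eq_mul, smul_eq_mul, mul_comm]

/-- Up to a small error, a tensor `∑ φ_i ⊗ ξ_i` is `∑ χ_j ⊗ η_j` for a partition of unity `χ` and
elements `η_j` of norm at most the injective norm, so that the type M inequality applies. -/
theorem isIntegralBound_functionalOperator [T2Space X] (l : StrongDual ℝ C(X, V)) :
    IsIntegralBound (functionalOperator l) ‖l‖ := by
  refine ⟨norm_nonneg _, fun t => ?_⟩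
  obtain ⟨k, φ, ξ, rfl⟩ := TensorProduct.exists_sum_tmul_eq t
  have hT := sum_norm_functionalOperator_le l
  generalize functionalOperator l = T at hT ⊢
  refine le_of_forall_pos_le_add fun δ hδ => ?_
  obtain ⟨n, χ, x, hχ, hχ1, happrox⟩ := exists_partition_approx φ
    (show 0 < δ / (‖T‖ * ∑ i, ‖ξ i‖ + 1) by positivity)
  generalize hε : δ / (‖T‖ * ∑ i, ‖ξ i‖ + 1) = ε at happrox
  have hε0 : 0 ≤ ε := by rw [← hε]; positivity
  obtain ⟨η, hη0⟩ : ∃ η : Fin n → StrongDual ℝ (StrongDual ℝ V),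
    ∀ j, η j = ∑ i, φ i (x j) • ξ i := ⟨_, fun _ => rfl⟩
  have hη : ∀ j, ‖η j‖ ≤ injectiveTensorNorm (∑ i, φ i ⊗ₜ[ℝ] ξ i) := fun j => by
    rw [hη0]
    exact norm_sum_smul_le_injectiveTensorNorm φ ξ (x j)
  have hdecomp : operatorForm T (∑ i, φ i ⊗ₜ[ℝ] ξ i) =
      ∑ i, ξ i (T (φ i - ∑ j, φ i (x j) • χ j)) + ∑ j, η j (T (χ j)) := by
    simp only [map_sum, operatorForm_tmul, map_sub, map_smul, Finset.sum_sub_distrib, hη0,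
      sum_apply, smul_apply]
    rw [Finset.sum_comm, sub_add_cancel]
  have h1 : |∑ i, ξ i (T (φ i - ∑ j, φ i (x j) • χ j))| ≤ δ := by
    calc |∑ i, ξ i (T (φ i - ∑ j, φ i (x j) • χ j))| ≤ ∑ i, ‖ξ i‖ * (‖T‖ * ε) :=
          norm_sum_le_of_le _ fun i _ => (ξ i).le_opNorm_of_le (T.le_opNorm_of_le (happrox i))
      _ = (‖T‖ * ∑ i, ‖ξ i‖) * ε := by rw [← Finset.sum_mul]; ring
      _ ≤ (‖T‖ * ∑ i, ‖ξ i‖ + 1) * ε := by gcongr; linarith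
      _ = δ := by rw [← hε]; exact mul_div_cancel₀ _ (by positivity)
  have hN := injectiveTensorNorm_nonneg (∑ i, φ i ⊗ₜ[ℝ] ξ i)
  generalize injectiveTensorNorm (∑ i, φ i ⊗ₜ[ℝ] ξ i) = N at hη hN ⊢
  have h2 : |∑ j, η j (T (χ j))| ≤ ‖l‖ * N := by
    calc |∑ j, η j (T (χ j))| ≤ ∑ j, N * ‖T (χ j)‖ :=
          norm_sum_le_of_le _ fun j _ => (η j).le_of_opNorm_le (hη j) _
      _ = N * ∑ j, ‖T (χ j)‖ := by rw [Finset.mul_sum]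
      _ ≤ N * (‖∑ j, χ j‖ * ‖l‖) :=
          mul_le_mul_of_nonneg_left (hT n χ hχ)
            hN
      _ ≤ N * (1 * ‖l‖) := by
          refine mul_le_mul_of_nonneg_left ?_ hN
          gcongr
          rw [hχ1]
          exact (ContinuousMap.norm_le _ zero_le_one).2 fun x => by simp
      _ = ‖l‖ * N := by ring
  rw [hdecomp]
  linarith [abs_add_le (∑ i, ξ i (T (φ i - ∑ j, φ i (x j) • χ j))) (∑ j, η j (T (χ j)))]

variable (X V) in
/-- The map `C(X, V)* → 𝓘(C(X), V*)` that sends `l` to `φ ↦ (v ↦ l(φ v))`. -/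
def integralOperatorOfFunctional [T2Space X] :
    StrongDual ℝ C(X, V) →L[ℝ] IntegralOperator C(X, ℝ) (StrongDual ℝ V) :=
  LinearMap.mkContinuous
    { toFun := fun l => ⟨functionalOperator l, _, isIntegralBound_functionalOperator l⟩
      map_add' := fun _ _ => rfl
      map_smul' := fun _ _ => rfl } 1 fun l => by
    rw [one_mul]
    exact IntegralOperator.norm_le_of_bound (isIntegralBound_functionalOperator l)

theorem toCLM_integralOperatorOfFunctional [T2Space X] (l : StrongDual ℝ C(X, V)) :
    IntegralOperator.toCLM (integralOperatorOfFunctional X V l) = functionalOperator l := rfl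

theorem integralOperatorOfFunctional_dual [T2Space X] {G : Type*} [Group G] [MulAction G X]
    [ContinuousConstSMul G X] (ρ : IsometricRep G V) (g : G) (l : StrongDual ℝ C(X, V)) :
    integralOperatorOfFunctional X V ((ρ.onC X).dual g l) =
      (functionRep G X).onIntegral ρ.dual g (integralOperatorOfFunctional X V l) := by
  refine IntegralOperator.toCLM_injective (ContinuousLinearMap.ext fun φ => ?_)
  ext v
  rw [IsometricRep.onIntegral_apply, toCLM_integralOperatorOfFunctional,
    toCLM_integralOperatorOfFunctional, functionalOperator_apply, IsometricRep.dual_apply,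
    IsometricRep.dual_apply, functionalOperator_apply]
  congr 1
  ext x
  change ρ g⁻¹ (φ (g⁻¹⁻¹ • x) • v) = φ (g⁻¹⁻¹ • x) • ρ g⁻¹ v
  rw [map_smul]

end FunctionalOperator

/-! ### The cocycle of differences of point masses -/

section PointMass

variable {G : Type*}

open Classical in
/-- The point mass at `g` in `ℓ^1(G, ℝ)`. -/
def pointMass (g : G) : ℓ^1(G, ℝ) := lp.single 1 g 1

theorem norm_pointMass (g : G) : ‖pointMass g‖ = 1 := by
  classical
  rw [pointMass, lp.norm_single (by simp), norm_one]

theorem tsumCLM_pointMass (g : G) : lp.tsumCLM ℝ G ℝ (pointMass g) = 1 := by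
  classical
  change ∑' h, pointMass g h = 1
  rw [tsum_eq_single g fun h hh => ?_]
  · exact lp.single_apply_self ..
  · exact lp.single_apply_ne (E := fun _ : G => ℝ) 1 g (1 : ℝ) hh

theorem leftRegular_pointMass [Group G] (g k : G) :
    leftRegular G g (pointMass k) = pointMass (g * k) := by
  classical
  ext h
  rw [leftRegular_apply, pointMass, pointMass, lp.single_apply, lp.single_apply, Pi.single_apply,
    Pi.single_apply]
  simp only [inv_mul_eq_iff_eq_mul]

theorem tsumCLM_leftRegular [Group G] (g : G) (v : ℓ^1(G, ℝ)) :
    lp.tsumCLM ℝ G ℝ (leftRegular G g v) = lp.tsumCLM ℝ G ℝ v :=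
  (Equiv.mulLeft g⁻¹).tsum_eq (fun h => v h)

end PointMass

/-- The kernel of the summation map on `ℓ^1(G, ℝ)`, in any universe above that of `G`. -/
theorem exists_sumZero_rep (G : Type u) [Group G] :
    ∃ (V : Type (max u v)) (_ : NormedAddCommGroup V) (_ : NormedSpace ℝ V) (_ : CompleteSpace V)
      (ρ : IsometricRep G V) (ι : V →ₗᵢ[ℝ] ℓ^1(G, ℝ)),
      (∀ g v, ι (ρ g v) = leftRegular G g (ι v)) ∧ (∀ v, lp.tsumCLM ℝ G ℝ (ι v) = 0) ∧
        ∀ g, ∃ v, ι v = pointMass g - pointMass 1 := by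
  let K : Submodule ℝ ℓ^1(G, ℝ) := LinearMap.ker (lp.tsumCLM ℝ G ℝ).toLinearMap
  have hK : IsClosed (K : Set ℓ^1(G, ℝ)) := (lp.tsumCLM ℝ G ℝ).isClosed_ker
  let e : ULift.{v} K ≃ₗᵢ[ℝ] K := LinearIsometryEquiv.ulift ℝ K
  let ι : ULift.{v} K →ₗᵢ[ℝ] ℓ^1(G, ℝ) := K.subtypeₗᵢ.comp e.toLinearIsometry
  have hι : ∀ v, ι v = (v.down : ℓ^1(G, ℝ)) := fun _ => rfl
  have hcompl : CompleteSpace (ULift.{v} K) := by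
    have : CompleteSpace K := hK.completeSpace_coe
    infer_instance
  let ρ : IsometricRep G (ULift.{v} K) := IsometricRep.ofContractions
    (fun g =>
      { toFun := fun v => ⟨leftRegular G g v.down,
          (tsumCLM_leftRegular g _).trans (LinearMap.mem_ker.1 v.down.2)⟩
        map_add' := fun v v' => ι.injective (map_add (leftRegular G g) _ _)
        map_smul' := fun c v => ι.injective (map_smul (leftRegular G g) c _) })
    (fun v => ι.injective (by
      change leftRegular G 1 _ = _
      rw [map_one]; rfl))
    (fun g h v => ι.injective ((leftRegular G).map_mul_apply g h _))
    (fun g v => ((leftRegular G g).norm_map _).le)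
  refine ⟨ULift.{v} K, inferInstance, inferInstance, hcompl, ρ, ι, fun g v => rfl,
    fun v => LinearMap.mem_ker.1 v.down.2, fun g => ⟨⟨⟨pointMass g - pointMass 1, ?_⟩⟩, rfl⟩⟩
  change lp.tsumCLM ℝ G ℝ (pointMass g - pointMass 1) = 0
  rw [map_sub, tsumCLM_pointMass, tsumCLM_pointMass, sub_self]

section Cocycle

variable {G X V E : Type*} [Group G] [TopologicalSpace X] [CompactSpace X] [MulAction G X]
  [ContinuousConstSMul G X] [NormedAddCommGroup V] [NormedSpace ℝ V] [NormedAddCommGroup E]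
  [NormedSpace ℝ E]

omit [Group G] in
theorem coboundaryMap_zero_apply (f : (Fin 1 → G) → E) (v : Fin 2 → G) :
    coboundaryMap G E 0 f v = f (fun _ => v 1) - f (fun _ => v 0) := by
  have h0 : (fun j : Fin 1 => v ((0 : Fin 2).succAbove j)) = fun _ => v 1 := by
    ext j; fin_cases j; rfl
  have h1 : (fun j : Fin 1 => v ((1 : Fin 2).succAbove j)) = fun _ => v 0 := by
    ext j; fin_cases j; rfl
  change ∑ i : Fin 2, (-1 : ℝ) ^ (i : ℕ) • f (fun j => v (i.succAbove j)) = _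
  rw [Fin.sum_univ_two, h0, h1]
  simp [sub_eq_add_neg]

/-- The cocycle `(g, h) ↦ δ_h - δ_g` has values in the constant maps with vanishing sum. If it is
the coboundary of an equivariant `f`, then `δ_g - f(g)` does not depend on `g`, so it is an
invariant element, and it sums to `1_X`. The space `E` is a predual of the coefficients, which
receives `C(X, V)*` and on which `V` acts by functionals. -/
theorem exists_invariant_of_subsingleton_boundedCohomology {ρ : IsometricRep G V}
    {ρE : IsometricRep G E} (ι : V →ₗᵢ[ℝ] ℓ^1(G, ℝ))
    (hι : ∀ g v, ι (ρ g v) = leftRegular G g (ι v)) (hι0 : ∀ v, lp.tsumCLM ℝ G ℝ (ι v) = 0)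
    (hd : ∀ g, ∃ v, ι v = pointMass g - pointMass 1)
    (p : StrongDual ℝ C(X, V) →L[ℝ] E) (hp : ∀ g l, p ((ρ.onC X).dual g l) = ρE g (p l))
    (j : V →L[ℝ] StrongDual ℝ E) (hj : ∀ g v, j (ρ g v) = ρE.dual g (j v))
    (hjp : ∀ v l, j v (p l) = l (constantMaps X V v))
    (hH : Subsingleton (BoundedCohomology ρE.dual 1)) :
    ∃ m : StrongDual ℝ (StrongDual ℝ C(X, ℓ^1(G, ℝ))),
      (∀ g : G, (crossedRep G X).dual.dual g m = m) ∧ SumsToOne G X m := by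
  choose d hd using hd
  have hdnorm : ∀ g, ‖d g‖ ≤ 2 := fun g => by
    rw [← ι.norm_map, hd]
    refine (norm_sub_le _ _).trans ?_
    rw [norm_pointMass, norm_pointMass]
    norm_num
  have hdd : ∀ g h k, ρ g (d k - d h) = d (g * k) - d (g * h) := fun g h k => ι.injective (by
    rw [hι, map_sub, hd, hd, sub_sub_sub_cancel_right, map_sub (leftRegular G g),
      leftRegular_pointMass, leftRegular_pointMass, map_sub, hd, hd, sub_sub_sub_cancel_right])
  -- the cocycle is the coboundary of the bounded map `b`, which need not be equivariant
  let b : (Fin 1 → G) → StrongDual ℝ E := fun v => j (d (v 0))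
  have hb : coboundaryMap G _ 0 b ∈ boundedCocycles ρE.dual 1 := by
    refine ⟨⟨⟨‖j‖ * 2 + ‖j‖ * 2, fun v => ?_⟩, fun g v => ?_⟩, coboundaryMap_comp 0 b⟩
    · rw [coboundaryMap_zero_apply]
      exact norm_sub_le_of_le (j.le_opNorm_of_le (hdnorm _)) (j.le_opNorm_of_le (hdnorm _))
    · rw [coboundaryMap_zero_apply, coboundaryMap_zero_apply]
      change j (d (g * v 1)) - j (d (g * v 0)) = ρE.dual g (j (d (v 1)) - j (d (v 0)))
      rw [← map_sub, ← map_sub, ← hj, hdd]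
  replace hH := Submodule.submoduleOf_eq_top.1 (Submodule.Quotient.subsingleton_iff.1 hH)
  obtain ⟨f, ⟨-, hf⟩, hfb⟩ := hH hb
  let ιX : C(X, V) →L[ℝ] C(X, ℓ^1(G, ℝ)) := ι.toContinuousLinearMap.compLeftContinuous ℝ X
  have hιX : ∀ v, ιX (constantMaps X V v) = constantMaps X _ (ι v) := fun v => rfl
  let q : StrongDual ℝ C(X, ℓ^1(G, ℝ)) →L[ℝ] E :=
    p.comp ((ContinuousLinearMap.compL ℝ C(X, V) C(X, ℓ^1(G, ℝ)) ℝ).flip ιX)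
  have hq : ∀ l, q l = p (l.comp ιX) := fun _ => rfl
  have hqequiv : ∀ g l, q ((crossedRep G X).dual g l) = ρE g (q l) := fun g l => by
    rw [hq, hq, ← hp]
    congr 1
    ext η
    change l (crossedRep G X g⁻¹ (ιX η)) = l (ιX (ρ.onC X g⁻¹ η))
    congr 1
    exact ContinuousMap.ext fun x => (hι g⁻¹ (η (g⁻¹⁻¹ • x))).symm
  let m : StrongDual ℝ (StrongDual ℝ C(X, ℓ^1(G, ℝ))) :=
    NormedSpace.inclusionInDoubleDual ℝ _ (constantMaps X _ (pointMass 1)) -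
      (f fun _ => 1).comp q
  have hm : ∀ g l, m l = l (constantMaps X _ (pointMass g)) - f (fun _ => g) (q l) := fun g l => by
    have h := congrFun hfb ![1, g]
    rw [coboundaryMap_zero_apply, coboundaryMap_zero_apply] at h
    have h2 := congrArg (fun k : StrongDual ℝ E => k (q l)) h
    change f (fun _ => g) (q l) - f (fun _ => 1) (q l) = j (d g) (q l) - j (d 1) (q l) at h2
    rw [hq, hjp, hjp] at h2
    change _ = l (ιX (constantMaps X V (d g))) - l (ιX (constantMaps X V (d 1))) at h2
    rw [hιX, hιX, hd, hd, sub_self, map_zero, map_zero, sub_zero, map_sub, map_sub] at h2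
    change l (constantMaps X _ (pointMass 1)) - f (fun _ => 1) (q l) = _
    rw [hq]
    linarith
  refine ⟨m, fun g => ?_, fun l => ?_⟩
  · ext l
    rw [IsometricRep.dual_apply, hm 1, hm g l, hqequiv]
    have h1 := hf g fun _ => 1
    rw [mul_one] at h1
    rw [h1, IsometricRep.dual_apply, IsometricRep.dual_apply, inv_inv]
    congr 2
    refine ContinuousMap.ext fun x => ?_
    change leftRegular G g (pointMass 1) = pointMass g
    rw [leftRegular_pointMass, mul_one]
  · have h0 : (l.comp (summation G X)).comp ιX = 0 := by
      ext η
      have : summation G X (ιX η) = 0 := ContinuousMap.ext fun x => hι0 (η x)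
      change l (summation G X (ιX η)) = 0
      rw [this, map_zero]
    have h1 : summation G X (constantMaps X _ (pointMass 1)) = 1 :=
      ContinuousMap.ext fun x => tsumCLM_pointMass 1
    rw [hm 1, hq, h0, map_zero, map_zero, sub_zero, ContinuousLinearMap.comp_apply, h1]

end Cocycle

section Evaluation

variable {X V : Type*} [TopologicalSpace X] [CompactSpace X] [NormedAddCommGroup V]
  [NormedSpace ℝ V]

variable (X V) in
/-- The functional `T ↦ T(1)(v)` on `𝓘(C(X), V*)`. -/
def integralEvaluation : V →L[ℝ] StrongDual ℝ (IntegralOperator C(X, ℝ) (StrongDual ℝ V)) :=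
  LinearMap.mkContinuous₂
    (LinearMap.mk₂ ℝ (fun v T => IntegralOperator.toCLM T 1 v)
      (fun v v' T => map_add _ v v') (fun c v T => map_smul _ c v)
      (fun v T T' => by rw [map_add]; rfl) (fun c v T => by rw [map_smul]; rfl)) 1 fun v T => by
    have h1 : ‖(1 : C(X, ℝ))‖ ≤ 1 := (ContinuousMap.norm_le _ zero_le_one).2 fun x => by simp
    have h := (IntegralOperator.isIntegralBound_norm T).2
      ((1 : C(X, ℝ)) ⊗ₜ NormedSpace.inclusionInDoubleDual ℝ V v)
    rw [operatorForm_tmul] at h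
    refine h.trans ?_
    rw [one_mul, mul_comm]
    refine mul_le_mul_of_nonneg_right ?_ (norm_nonneg _)
    refine Real.iSup_le ?_ (norm_nonneg _)
    rintro ⟨⟨φ, ψ⟩, hφ, hψ⟩
    rw [tensorEval_tmul, abs_mul]
    calc |φ 1| * |ψ (NormedSpace.inclusionInDoubleDual ℝ V v)| ≤ (1 * 1) * (1 * ‖v‖) := by
          gcongr
          · exact φ.le_of_opNorm_le_of_le hφ h1
          · exact ψ.le_of_opNorm_le_of_le hψ (NormedSpace.double_dual_bound ℝ V v)
      _ = ‖v‖ := by ring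

theorem integralEvaluation_apply (v : V) (T : IntegralOperator C(X, ℝ) (StrongDual ℝ V)) :
    integralEvaluation X V v T = IntegralOperator.toCLM T 1 v := rfl

end Evaluation

section Coefficients

variable {G : Type u} [Group G] {X : Type v} [TopologicalSpace X] [CompactSpace X]
  [MulAction G X] [ContinuousConstSMul G X]

theorem exists_invariant_of_bidual_cohomology
    (h : ∀ (V : Type (max u v w)) [NormedAddCommGroup V] [NormedSpace ℝ V] [CompleteSpace V]
      (ρ : IsometricRep G V), Subsingleton (BoundedCohomology (ρ.onC X).dual.dual 1)) :
    ∃ m : StrongDual ℝ (StrongDual ℝ C(X, ℓ^1(G, ℝ))),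
      (∀ g : G, (crossedRep G X).dual.dual g m = m) ∧ SumsToOne G X m := by
  obtain ⟨V, _, _, _, ρ, ι, hι, hι0, hd⟩ := exists_sumZero_rep.{u, max v w} G
  refine exists_invariant_of_subsingleton_boundedCohomology ι hι hι0 hd
    (ContinuousLinearMap.id ℝ _) (fun g l => rfl)
    ((NormedSpace.inclusionInDoubleDual ℝ _).comp (constantMaps X V)) (fun g v => ?_)
    (fun v l => rfl) (h V ρ)
  ext l
  change l (constantMaps X V (ρ g v)) = l (ρ.onC X g⁻¹⁻¹ (constantMaps X V v))
  rw [inv_inv]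
  rfl

theorem exists_invariant_of_integral_cohomology [T2Space X]
    (h : ∀ (W : Type (max u v w)) [NormedAddCommGroup W] [NormedSpace ℝ W] [CompleteSpace W]
      (ρ : IsometricRep G W),
        Subsingleton (BoundedCohomology ((functionRep G X).onIntegral ρ).dual 1)) :
    ∃ m : StrongDual ℝ (StrongDual ℝ C(X, ℓ^1(G, ℝ))),
      (∀ g : G, (crossedRep G X).dual.dual g m = m) ∧ SumsToOne G X m := by
  obtain ⟨V, _, _, _, ρ, ι, hι, hι0, hd⟩ := exists_sumZero_rep.{u, max v w} G
  refine exists_invariant_of_subsingleton_boundedCohomology ι hι hι0 hd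
    (integralOperatorOfFunctional X V) (integralOperatorOfFunctional_dual ρ)
    (integralEvaluation X V) (fun g v => ?_) (fun v l => ?_) (h _ ρ.dual)
  · ext T
    rw [integralEvaluation_apply, IsometricRep.dual_apply, integralEvaluation_apply,
      IsometricRep.onIntegral_apply, IsometricRep.dual_apply, inv_inv]
    congr 2
  · rw [integralEvaluation_apply, toCLM_integralOperatorOfFunctional, functionalOperator_apply,
      one_smul]

end Coefficients

end

/-! ### The equivalences -/

section Amenable

variable {G X E V : Type*} [Group G] [TopologicalSpace X] [CompactSpace X] [Nonempty X]
  [MulAction G X] [ContinuousConstSMul G X] [NormedAddCommGroup E] [NormedSpace ℝ E]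
  [NormedAddCommGroup V] [NormedSpace ℝ V]

theorem IsTopologicallyAmenable.hasEquivariantMean (h : IsTopologicallyAmenable G X)
    {ρ : IsometricRep G E} {π : C(X, ℝ) →ₐ[ℝ] (E →L[ℝ] E)} (hπ : IsGXModule ρ π)
    (hC : IsTypeC (dualCModule π)) : HasEquivariantMean ρ.dual := by
  obtain ⟨m, hm, -, hinv, hsum⟩ := h.exists_invariant
  exact hπ.hasEquivariantMean hC hm.le hinv hsum

theorem IsTopologicallyAmenable.hasEquivariantMean_integral (h : IsTopologicallyAmenable G X)
    (ρ : IsometricRep G V) : HasEquivariantMean ((functionRep G X).onIntegral ρ).dual :=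
  h.hasEquivariantMean (isGXModule_integralModule ρ) isTypeM_integralModule.isTypeC_dual

end Amenable

section Dual

variable {G X V : Type*} [Group G] [TopologicalSpace X] [CompactSpace X]
  [MulAction G X] [ContinuousConstSMul G X] [NormedAddCommGroup V] [NormedSpace ℝ V]

theorem isGXModule_dual_pointwiseModule (ρ : IsometricRep G V) :
    IsGXModule (ρ.onC X).dual (dualCModule (pointwiseModule X V)) :=
  (isGXModule_pointwiseModule ρ).dual

theorem isTypeM_dual_pointwiseModule : IsTypeM (dualCModule (pointwiseModule X V)) :=
  isTypeC_pointwiseModule.isTypeM_dual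

theorem isTypeC_bidual_pointwiseModule :
    IsTypeC (dualCModule (dualCModule (pointwiseModule X V))) :=
  isTypeM_dual_pointwiseModule.isTypeC_dual

end Dual

theorem mainTheorem1 (G : Type u) [Group G] (X : Type v) [TopologicalSpace X]
    [CompactSpace X] [T2Space X] [Nonempty X] [MulAction G X] [ContinuousConstSMul G X] :
    List.TFAE [
      -- (1)
      IsTopologicallyAmenable G X,
      -- (2)
      (∀ (V : Type (max u v w)) [NormedAddCommGroup V] [NormedSpace ℝ V] [CompleteSpace V]
        (ρ : IsometricRep G V) (n : ℕ), 1 ≤ n →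
          Subsingleton (BoundedCohomology (ρ.onC X).dual.dual n)),
      -- (3)
      (∀ (W : Type (max u v w)) [NormedAddCommGroup W] [NormedSpace ℝ W] [CompleteSpace W]
        (ρ : IsometricRep G W) (n : ℕ), 1 ≤ n →
          Subsingleton (BoundedCohomology ((functionRep G X).onIntegral ρ).dual n)),
      -- (4)
      (∀ (E : Type (max u v w)) [NormedAddCommGroup E] [NormedSpace ℝ E] [CompleteSpace E]
        (ρ : IsometricRep G E) (π : C(X, ℝ) →ₐ[ℝ] (E →L[ℝ] E)),
          IsGXModule ρ π → IsTypeM π → ∀ n : ℕ, 1 ≤ n →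
            Subsingleton (BoundedCohomology ρ.dual n)),
      -- (5), for the coefficients of (2)
      (∀ (V : Type (max u v w)) [NormedAddCommGroup V] [NormedSpace ℝ V] [CompleteSpace V]
        (ρ : IsometricRep G V), Subsingleton (BoundedCohomology (ρ.onC X).dual.dual 1)),
      -- (5), for the coefficients of (3)
      (∀ (W : Type (max u v w)) [NormedAddCommGroup W] [NormedSpace ℝ W] [CompleteSpace W]
        (ρ : IsometricRep G W),
          Subsingleton (BoundedCohomology ((functionRep G X).onIntegral ρ).dual 1)),
      -- (5), for the coefficients of (4)
      (∀ (E : Type (max u v w)) [NormedAddCommGroup E] [NormedSpace ℝ E] [CompleteSpace E]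
        (ρ : IsometricRep G E) (π : C(X, ℝ) →ₐ[ℝ] (E →L[ℝ] E)),
          IsGXModule ρ π → IsTypeM π → Subsingleton (BoundedCohomology ρ.dual 1)),
      -- (6)
      (∀ (V : Type (max u v w)) [NormedAddCommGroup V] [NormedSpace ℝ V] [CompleteSpace V]
        (ρ : IsometricRep G V), IsRelativelyInjective.{max u v w} (ρ.onC X).dual.dual),
      -- (7)
      (∀ (W : Type (max u v w)) [NormedAddCommGroup W] [NormedSpace ℝ W] [CompleteSpace W]
        (ρ : IsometricRep G W),
          IsRelativelyInjective.{max u v w} ((functionRep G X).onIntegral ρ).dual),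
      -- (8)
      (∀ (E : Type (max u v w)) [NormedAddCommGroup E] [NormedSpace ℝ E] [CompleteSpace E]
        (ρ : IsometricRep G E) (π : C(X, ℝ) →ₐ[ℝ] (E →L[ℝ] E)),
          IsGXModule ρ π → IsTypeC (dualCModule π) →
            IsRelativelyInjective.{max u v w} ρ.dual),
      -- (9)
      (∃ m : StrongDual ℝ (StrongDual ℝ C(X, ℓ^1(G, ℝ))),
        (∀ g : G, (crossedRep G X).dual.dual g m = m) ∧ SumsToOne G X m),
      -- (10)
      (∃ m : StrongDual ℝ (StrongDual ℝ C(X, ℓ^1(G, ℝ))),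
        ‖m‖ = 1 ∧ IsPositiveBidual G X m ∧
          (∀ g : G, (crossedRep G X).dual.dual g m = m) ∧ SumsToOne G X m)] := by
  -- In the list, 2–4 are vanishing in all positive degrees, 5–7 vanishing in degree one, 8–10
  -- relative injectivity, and 11, 12 the existence of an invariant element.
  tfae_have 1 → 12 := fun h => h.exists_invariant
  tfae_have 12 → 11 := by
    rintro ⟨m, -, -, hinv, hsum⟩
    exact ⟨m, hinv, hsum⟩
  tfae_have 11 → 1 := by
    rintro ⟨m, hinv, hsum⟩
    exact isTopologicallyAmenable_of_invariant hinv hsum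
  tfae_have 1 → 3 := fun h W _ _ _ ρ n hn =>
    (h.hasEquivariantMean_integral ρ).subsingleton_boundedCohomology hn
  tfae_have 1 → 4 := fun h E _ _ _ ρ π hπ hM n hn =>
    (h.hasEquivariantMean hπ hM.isTypeC_dual).subsingleton_boundedCohomology hn
  tfae_have 4 → 2 := fun h V _ _ _ ρ n hn =>
    h _ _ _ (isGXModule_dual_pointwiseModule ρ) isTypeM_dual_pointwiseModule n hn
  tfae_have 1 → 9 := fun h W _ _ _ ρ => (h.hasEquivariantMean_integral ρ).isRelativelyInjective
  tfae_have 1 → 10 := fun h E _ _ _ ρ π hπ hC => (h.hasEquivariantMean hπ hC).isRelativelyInjective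
  tfae_have 10 → 8 := fun h V _ _ _ ρ =>
    h _ _ _ (isGXModule_dual_pointwiseModule ρ) isTypeC_bidual_pointwiseModule
  tfae_have 8 → 5 := fun h V _ _ _ ρ =>
    (IsRelativelyInjective.hasEquivariantMean.{u, max u v w}
      (h V ρ)).subsingleton_boundedCohomology le_rfl
  tfae_have 9 → 6 := fun h W _ _ _ ρ =>
    (IsRelativelyInjective.hasEquivariantMean.{u, max u v w}
      (h W ρ)).subsingleton_boundedCohomology le_rfl
  tfae_have 2 → 5 := fun h V _ _ _ ρ => h V ρ 1 le_rfl
  tfae_have 3 → 6 := fun h W _ _ _ ρ => h W ρ 1 le_rfl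
  tfae_have 4 → 7 := fun h E _ _ _ ρ π hπ hM => h E ρ π hπ hM 1 le_rfl
  tfae_have 7 → 5 := fun h V _ _ _ ρ =>
    h _ _ _ (isGXModule_dual_pointwiseModule ρ) isTypeM_dual_pointwiseModule
  tfae_have 5 → 11 := exists_invariant_of_bidual_cohomology.{u, v, w}
  tfae_have 6 → 11 := exists_invariant_of_integral_cohomology.{u, v, w}
  tfae_finish
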